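/- A PCSTP instance $P=(V,E,c,p)$ is a finite connected simple graph $(V,E)$ with edge costs $c>0$ and vertex prizes $p\ge 0$; a solution is a tree $S\subseteq(V,E)$, with cost $C(S)=\sum_{e\in E(S)}c(e)+\sum_{v\in V\setminus V(S)}p(v)$, and it is optimal if $C(S)$ is minimum. Let $T_p=\{v: p(v)>0\}$ be the set of potential terminals and $M=\sum_{t\in T_p}p(t)$. A Steiner arborescence instance $(W,A,c',T',r')$ consists of a digraph $(W,A)$, arc costs $c'\ge 0$, terminals $T'\subseteq W$ and a root $r'\in T'$; its cut constraints are $x(\delta^-(U))\ge 1$ for all $U\subset W$ with $r'\notin U$ and $U\cap T'\neq\emptyset$. *PrizeCut.* Let $(V',A',T',c',r')$ have vertices $V\cup\{r',v_0'\}\cup\{t' : t\in T_p\}$; arcs $(v,w),(w,v)$ of cost $c(\{v,w\})$ for $\{v,w\}\in E$ and, for each $t\in T_p$, arcs $(r',t)$ of cost $M$, $(t,v_0')$ and $(t,t')$ of cost $0$, and $(v_0',t')$ of cost $p(t)$; terminals $\{t':t\in T_p\}\cup\{r'\}$; and root $r'$. Let $v_{LP}(\mathrm{PrizeCut}(P))$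 be the minimum of $c'^{\top}x-M$ over all $x\in[0,1]^{A'}$, $y\in[0,1]^E$ satisfying the cut constraints and $y(\{v,w\})=x((v,w))+x((w,v))$ for all $\{v,w\}\in E$. *PrizeRCut.* For a nonempty set $T_0\subseteq V$ of fixed terminals and $t_p,t_q\in T_0$, let $(V',A',T',c',r')$ have vertices $V\cup\{t':t\in T_p\setminus T_0\}$; arcs $(v,w),(w,v)$ of cost $c(\{v,w\})$ for $\{v,w\}\in E$ and, for each $t\in T_p\setminus T_0$, arcs $(t,t')$ of cost $0$ and $(t_p,t')$ of cost $p(t)$; terminals $\{t':t\in T_p\setminus T_0\}\cup T_0$; and root $r'=t_q$. Let $v_{LP}(\mathrm{PrizeRCut}(I_{T_0},t_p,t_q))$ be the minimum of $c'^{\top}x$ over all $x\in[0,1]^{A'}$, $y\in[0,1]^E$ satisfying the corresponding cut constraints and $y(\{v,w\})=x((v,w))+x((w,v))$ for all $\{v,w\}\in E$. **Proposition.** (a) Let $P=(V,E,c,p)$ be a PCSTP instance and let $\emptyset\ne T_0\subseteq T_p$ be such that $T_0\subseteq V(S)$ for at least one optimal solution $S$ of $P$. Then for all $t_p,t_q\in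 T_0$ both minima are attained and $$v_{LP}(\mathrm{PrizeCut}(P))\le v_{LP}(\mathrm{PrizeRCut}(I_{T_0},t_p,t_q)).$$ (b) The inequality can be strict. Let $0<\varepsilon<1$ and let $P$ be the instance on $V=\{v_0,\dots,v_6\}$ with edges $\{v_0,v_2\},\{v_0,v_4\},\{v_0,v_6\}$ of cost $1$ and edges $\{v_1,v_2\},\{v_2,v_3\},\{v_3,v_4\},\{v_4,v_5\},\{v_5,v_6\},\{v_6,v_1\}$ of cost $2$, and with $p(v_0)=p(v_1)=p(v_3)=p(v_5)=4$, $p(v_2)=p(v_6)=0$ and $p(v_4)=\varepsilon$. Then $T_0=\{v_0,v_1,v_3,v_4,v_5\}$ is a set of potential terminals contained in some optimal solution, and for all $t_p,t_q\in T_0$ $$v_{LP}(\mathrm{PrizeCut}(P))=7.5+\frac{\varepsilon}{2}<8=v_{LP}(\mathrm{PrizeRCut}(I_{T_0},t_p,t_q)).$$ -/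

import Mathlib

/-- An instance `(V, E, c, p)` of the prize-collecting Steiner tree problem: a connected undirected
graph with positive edge costs and nonnegative vertex prizes. Only the values of `c` on edges
are used. -/
structure PCSTP (V : Type*) where
  G : SimpleGraph V
  c : Sym2 V → ℝ
  p : V → ℝ
  connected : G.Connected
  c_pos : ∀ e ∈ G.edgeSet, 0 < c e
  p_nonneg : ∀ v, 0 ≤ p v

/-- A Steiner arborescence instance `(W, A, c, T, r)`; only the values of `cost` on arcs
are used. -/
structure SAP (W : Type*) where
  arcs : Set (W × W)
  cost : W × W → ℝ
  cost_nonneg : ∀ a ∈ arcs, 0 ≤ cost a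
  terminals : Set W
  root : W
  root_mem : root ∈ terminals

namespace SAP

variable {W : Type*} (D : SAP W)

/-- The arcs entering `U`, i.e. `δ⁻(U)`. -/
def inCut (U : Set W) : Set (W × W) := {a ∈ D.arcs | a.1 ∉ U ∧ a.2 ∈ U}

open Classical in
/-- The directed cut constraints `x(δ⁻(U)) ≥ 1`. -/
def CutConstraints [Fintype W] (x : W × W → ℝ) : Prop :=
  ∀ U : Set W, D.root ∉ U → (U ∩ D.terminals).Nonempty → 1 ≤ ∑ a with a ∈ D.inCut U, x a

/-- Feasible points of the directed cut formulation with variables ranging over `B`: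
`B = {0, 1}` is the integer program, `B = [0, 1]` its LP relaxation. A vector indexed by the arcs
is represented by its extension by zero to all pairs. -/
def DCut [Fintype W] (B : Set ℝ) : Set (W × W → ℝ) :=
  {x | D.CutConstraints x ∧ (∀ a ∈ D.arcs, x a ∈ B) ∧ ∀ a ∉ D.arcs, x a = 0}

open Classical in
/-- The cost `cᵀ x`. -/
noncomputable def value [Fintype W] (x : W × W → ℝ) : ℝ :=
  ∑ a with a ∈ D.arcs, D.cost a * x a

end SAP

namespace PCSTP

variable {V : Type*}

/-- The potential terminals: the vertices of positive prize. -/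
def potTerminals (I : PCSTP V) : Set V := {v | 0 < I.p v}

open Classical in
/-- The objective `C(S)`: the cost of the edges of `S` plus the prizes of the vertices
missed by `S`. -/
noncomputable def treeCost [Fintype V] (I : PCSTP V) (S : I.G.Subgraph) : ℝ :=
  ∑ e with e ∈ S.edgeSet, I.c e + ∑ v with v ∉ S.verts, I.p v

/-- `S` is an optimal solution: a tree in `G` of minimum cost. -/
def IsOptimal [Fintype V] (I : PCSTP V) (S : I.G.Subgraph) : Prop :=
  S.coe.IsTree ∧ ∀ S' : I.G.Subgraph, S'.coe.IsTree → I.treeCost S ≤ I.treeCost S'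

end PCSTP

/-- Vertices of the transformed instance: the original vertices, a copy `t'` of each `t` in `T`,
the artificial root `r'` and the vertex `v₀'`. -/
inductive PCVertex (V T : Type*)
  | vert (v : V)
  | copy (t : T)
  | root
  | hub
  deriving Fintype, DecidableEq

/-- Arcs of the Steiner arborescence instance obtained from a prize-collecting instance. -/
inductive PCArc {V : Type*} (I : PCSTP V) :
    PCVertex V I.potTerminals × PCVertex V I.potTerminals → Prop
  | edge {v w : V} : I.G.Adj v w → PCArc I (.vert v, .vert w)
  | fromRoot (t : I.potTerminals) : PCArc I (.root, .vert t)
  | toHub (t : I.potTerminals) : PCArc I (.vert t, .hub)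
  | toCopy (t : I.potTerminals) : PCArc I (.vert t, .copy t)
  | hubToCopy (t : I.potTerminals) : PCArc I (.hub, .copy t)

/-- Vertices of the transformed rooted instance: the original vertices and a copy `t'` of each
`t` in `T`. -/
inductive RPCVertex (V T : Type*)
  | vert (v : V)
  | copy (t : T)
  deriving Fintype, DecidableEq

/-- An instance `(V, E, T_f, c, p)` of the rooted prize-collecting Steiner tree problem, with a
nonempty set `T_f` of fixed terminals. -/
structure RPCSTP (V : Type*) extends PCSTP V where
  fixed : Set V
  fixed_nonempty : fixed.Nonempty

namespace PCSTP

variable {V : Type*}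

open Classical in
noncomputable instance [Fintype V] (I : PCSTP V) : Fintype I.potTerminals := Fintype.ofFinite _

open Classical in
/-- The big-M constant: the sum of the prizes of all potential terminals. -/
noncomputable def bigM [Fintype V] (I : PCSTP V) : ℝ := ∑ v with v ∈ I.potTerminals, I.p v

/-- Arc costs of the transformed instance: `c` on both orientations of an edge, `M` on arcs
leaving `r'`, `p(t)` on the arc `(v₀', t')`, and `0` otherwise. -/
noncomputable def sapCost [Fintype V] (I : PCSTP V) :
    PCVertex V I.potTerminals × PCVertex V I.potTerminals → ℝ
  | (.vert v, .vert w) => I.c s(v, w)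
  | (.root, _) => I.bigM
  | (.hub, .copy t) => I.p t
  | _ => 0

theorem bigM_nonneg [Fintype V] (I : PCSTP V) : 0 ≤ I.bigM :=
  Finset.sum_nonneg fun v _ => I.p_nonneg v

/-- The transformation of a prize-collecting instance to a Steiner arborescence instance. -/
noncomputable def toSAP [Fintype V] (I : PCSTP V) : SAP (PCVertex V I.potTerminals) where
  arcs := {a | PCArc I a}
  cost := I.sapCost
  cost_nonneg := by
    rintro _ (h | t | t | t | t)
    · exact (I.c_pos _ h).le
    · exact I.bigM_nonneg
    · exact le_rfl
    · exact le_rfl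
    · exact I.p_nonneg t
  terminals := insert .root (Set.range .copy)
  root := .root
  root_mem := Set.mem_insert _ _

/-- Feasible pairs `(x, y)` of the formulation PrizeCut, with variables ranging over `B`
(`B = {0, 1}`: integer program, `B = [0, 1]`: LP relaxation). The `y` variables are also extended
by zero. -/
def prizeCut [Fintype V] (I : PCSTP V) (B : Set ℝ) :
    Set ((PCVertex V I.potTerminals × PCVertex V I.potTerminals → ℝ) × (Sym2 V → ℝ)) :=
  {z | z.1 ∈ I.toSAP.DCut B ∧
    (∀ v w, I.G.Adj v w → z.2 s(v, w) = z.1 (.vert v, .vert w) + z.1 (.vert w, .vert v)) ∧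
    (∀ e ∈ I.G.edgeSet, z.2 e ∈ B) ∧ ∀ e ∉ I.G.edgeSet, z.2 e = 0}

/-- Objective values `c'ᵀ x - M` of the feasible points of the LP relaxation of PrizeCut. -/
def prizeCutLPValues [Fintype V] (I : PCSTP V) : Set ℝ :=
  (fun z => I.toSAP.value z.1 - I.bigM) '' I.prizeCut (Set.Icc 0 1)

/-- The optimal value of the LP relaxation of PrizeCut. -/
noncomputable def vLPPrizeCut [Fintype V] (I : PCSTP V) : ℝ := sInf I.prizeCutLPValues

/-- The rooted instance with the same data and the given set of fixed terminals. -/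
def rooted (I : PCSTP V) (T₀ : Set V) (h : T₀.Nonempty) : RPCSTP V where
  toPCSTP := I
  fixed := T₀
  fixed_nonempty := h

end PCSTP

namespace RPCSTP

variable {V : Type*}

/-- The potential terminals that are not fixed. -/
def free (J : RPCSTP V) : Set V := J.potTerminals \ J.fixed

open Classical in
noncomputable instance [Fintype V] (J : RPCSTP V) : Fintype J.free := Fintype.ofFinite _

end RPCSTP

/-- Arcs of the Steiner arborescence instance obtained from a rooted instance, where the arcs
`(tₚ, t')` start at the fixed terminal `tₚ`. -/
inductive RPCArc {V : Type*} (J : RPCSTP V) (tp : J.fixed) :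
    RPCVertex V J.free × RPCVertex V J.free → Prop
  | edge {v w : V} : J.G.Adj v w → RPCArc J tp (.vert v, .vert w)
  | toCopy (t : J.free) : RPCArc J tp (.vert t, .copy t)
  | fixedToCopy (t : J.free) : RPCArc J tp (.vert tp, .copy t)

namespace RPCSTP

variable {V : Type*}

open Classical in
/-- Arc costs of the transformed rooted instance: `c` on both orientations of an edge, `p(t)` on
the arc `(tₚ, t')`, and `0` on the arc `(t, t')`. -/
noncomputable def sapCost (J : RPCSTP V) (tp : J.fixed) :
    RPCVertex V J.free × RPCVertex V J.free → ℝ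
  | (.vert v, .vert w) => J.c s(v, w)
  | (.vert v, .copy t) => if v = tp then J.p t else 0
  | _ => 0

/-- The transformation of a rooted instance to a Steiner arborescence instance with root `t_q`. -/
noncomputable def toSAP (J : RPCSTP V) (tp tq : J.fixed) : SAP (RPCVertex V J.free) where
  arcs := {a | RPCArc J tp a}
  cost := J.sapCost tp
  cost_nonneg := by
    rintro _ (h | t | t)
    · exact (J.c_pos _ h).le
    · simp only [sapCost]
      split_ifs
      · exact J.p_nonneg t
      · exact le_rfl
    · simp only [sapCost, if_true]
      exact J.p_nonneg t
  terminals := Set.range .copy ∪ RPCVertex.vert '' J.fixed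
  root := .vert tq
  root_mem := Or.inr ⟨tq, tq.2, rfl⟩

/-- Feasible pairs `(x, y)` of the formulation PrizeRCut for the choice `tp, tq` of fixed
terminals, with variables ranging over `B`. -/
def prizeRCut [Fintype V] (J : RPCSTP V) (tp tq : J.fixed) (B : Set ℝ) :
    Set ((RPCVertex V J.free × RPCVertex V J.free → ℝ) × (Sym2 V → ℝ)) :=
  {z | z.1 ∈ (J.toSAP tp tq).DCut B ∧
    (∀ v w, J.G.Adj v w → z.2 s(v, w) = z.1 (.vert v, .vert w) + z.1 (.vert w, .vert v)) ∧
    (∀ e ∈ J.G.edgeSet, z.2 e ∈ B) ∧ ∀ e ∉ J.G.edgeSet, z.2 e = 0}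

/-- Objective values `c'ᵀ x` of the feasible points of the LP relaxation of PrizeRCut. -/
def prizeRCutLPValues [Fintype V] (J : RPCSTP V) (tp tq : J.fixed) : Set ℝ :=
  (fun z => (J.toSAP tp tq).value z.1) '' J.prizeRCut tp tq (Set.Icc 0 1)

/-- The optimal value of the LP relaxation of PrizeRCut. -/
noncomputable def vLPPrizeRCut [Fintype V] (J : RPCSTP V) (tp tq : J.fixed) : ℝ :=
  sInf (J.prizeRCutLPValues tp tq)

end RPCSTP

/-- The wheel graph: the hub `0` is joined to `2, 4, 6`, and the rim is the cycle
`1, 2, 3, 4, 5, 6`. -/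
def wheelGraph : SimpleGraph (Fin 7) :=
  SimpleGraph.fromEdgeSet {s(0, 2), s(0, 4), s(0, 6),
    s(1, 2), s(2, 3), s(3, 4), s(4, 5), s(5, 6), s(6, 1)}

/-- The wheel instance: edges at the hub cost `1`, rim edges cost `2`; the vertices `0, 1, 3, 5`
have prize `4`, the vertex `4` has prize `ε`, and `2, 6` have prize `0`. -/
noncomputable def wheel (ε : ℝ) (hε : 0 < ε) : PCSTP (Fin 7) where
  G := wheelGraph
  c := fun e => if 0 ∈ e then 1 else 2
  p := ![4, 4, 0, 4, ε, 4, 0]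
  connected := by
    have h2 : wheelGraph.Adj 0 2 := by simp [wheelGraph]
    have h4 : wheelGraph.Adj 0 4 := by simp [wheelGraph]
    have h6 : wheelGraph.Adj 0 6 := by simp [wheelGraph]
    have h1 : wheelGraph.Adj 2 1 := by simp [wheelGraph]
    have h3 : wheelGraph.Adj 2 3 := by simp [wheelGraph]
    have h5 : wheelGraph.Adj 4 5 := by simp [wheelGraph]
    have h : ∀ v, wheelGraph.Reachable 0 v := by
      intro v
      fin_cases v
      · exact SimpleGraph.Reachable.refl _
      · exact h2.reachable.trans h1.reachable
      · exact h2.reachable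
      · exact h2.reachable.trans h3.reachable
      · exact h4.reachable
      · exact h4.reachable.trans h5.reachable
      · exact h6.reachable
    exact SimpleGraph.connected_iff_exists_forall_reachable _ |>.2 ⟨0, h⟩
  c_pos := by
    intro e _
    split_ifs <;> norm_num
  p_nonneg := by
    intro v
    fin_cases v <;> simp [hε.le]

/-- The fixed terminals `0, 1, 3, 4, 5` of the wheel example. -/
def wheelFixed : Set (Fin 7) := {0, 1, 3, 4, 5}

theorem wheelFixed_nonempty : wheelFixed.Nonempty := ⟨0, by simp [wheelFixed]⟩

/-! Part (a). A feasible point of PrizeRCut becomes one of PrizeCut whose cost is larger by exactly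
`M` (`unrootArcs`, `value_unrootArcs`). One unit is sent along `(r', t_q)`, along `(t_p, v₀')` and
along `(t, t')` for each fixed `t`, and a free copy `t'` receives from `v₀'` what it received from
`t_p`. A cut entered by one of these unit arcs is satisfied. Any other cut pulls back to a cut of
the rooted instance of no larger weight (`unroot_mem_prizeCut`). The minima are attained because
both feasible regions are compact, and the arcs on shortest paths from `t_q` give a feasible point.

Part (b). Every potential terminal of the wheel is fixed, so only the root `t_q` matters in the
rooted relaxation. The tree `12, 20, 04, 43, 45` costs 8 and can be directed away from any root. For
each root a few weighted cuts give the matching lower bound. PrizeCut does better because its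
artificial root can split its unit: one half enters at `3`, the other at `5`, and every edge carries
`1/2`. The edges cost `15/2`, and the copy of `4` draws its missing half from `v₀'` for `ε/2`. For
the lower bound, the cut constraints written in coordinates do not involve `ε` and the objective is
affine in `ε`, so the bounds `15/2` at `ε = 0` and `8` at `ε = 1` interpolate. Optimality of the
tree is a vertex count (`le_wheel_treeCost`). -/

/-! ### Cuts, values and compactness of the relaxations -/

namespace SAP

theorem mem_inCut {W : Type*} {D : SAP W} {U : Set W} {a : W × W} :
    a ∈ D.inCut U ↔ a ∈ D.arcs ∧ a.1 ∉ U ∧ a.2 ∈ U := Iff.rfl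

variable {W : Type*} [Fintype W] (D : SAP W)

open Classical in
theorem sum_inCut (U : Set W) (x : W × W → ℝ) :
    ∑ a with a ∈ D.inCut U, x a =
      ∑ a with a ∈ D.arcs, if a.1 ∉ U ∧ a.2 ∈ U then x a else 0 := by
  rw [Finset.sum_ite, Finset.sum_const_zero, add_zero, Finset.filter_filter]
  simp only [mem_inCut]

open Classical in
theorem le_sum_inCut {U : Set W} {x : W × W → ℝ} (hx : ∀ a ∈ D.arcs, 0 ≤ x a) {a : W × W}
    (ha : a ∈ D.arcs) (h₁ : a.1 ∉ U) (h₂ : a.2 ∈ U) :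
    x a ≤ ∑ a with a ∈ D.inCut U, x a :=
  Finset.single_le_sum (f := x) (fun b hb => hx b (Finset.mem_filter.1 hb).2.1)
    (Finset.mem_filter.2 ⟨Finset.mem_univ _, ha, h₁, h₂⟩)

theorem isClosed_DCut {B : Set ℝ} (hB : IsClosed B) : IsClosed (D.DCut B) := by
  classical
  have h1 : IsClosed {x | D.CutConstraints x} := by
    simp only [CutConstraints, Set.ofPred_forall]
    refine isClosed_iInter fun U => isClosed_iInter fun _ => isClosed_iInter fun _ => ?_
    exact isClosed_le continuous_const (by fun_prop)
  have h2 : IsClosed {x : W × W → ℝ | ∀ a ∈ D.arcs, x a ∈ B} := by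
    simp only [Set.ofPred_forall]
    exact isClosed_iInter fun a => isClosed_iInter fun _ => hB.preimage (continuous_apply a)
  have h3 : IsClosed {x : W × W → ℝ | ∀ a ∉ D.arcs, x a = 0} := by
    simp only [Set.ofPred_forall]
    exact isClosed_iInter fun a => isClosed_iInter fun _ =>
      isClosed_eq (continuous_apply a) continuous_const
  exact h1.inter (h2.inter h3)

theorem continuous_value : Continuous D.value := by
  unfold value
  fun_prop

theorem mem_Icc_of_mem_DCut {x : W × W → ℝ} (hx : x ∈ D.DCut (Set.Icc 0 1)) (a : W × W) :
    x a ∈ Set.Icc (0 : ℝ) 1 := by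
  by_cases ha : a ∈ D.arcs
  · exact hx.2.1 a ha
  · rw [hx.2.2 a ha]
    simp

/-- The extended formulation with edge variables `y` is compact. -/
theorem isCompact_edgeFormulation {V : Type*} [Fintype V] (G : SimpleGraph V) (f : V → W) :
    IsCompact {z : (W × W → ℝ) × (Sym2 V → ℝ) | z.1 ∈ D.DCut (Set.Icc 0 1) ∧
      (∀ v w, G.Adj v w → z.2 s(v, w) = z.1 (f v, f w) + z.1 (f w, f v)) ∧
      (∀ e ∈ G.edgeSet, z.2 e ∈ Set.Icc (0 : ℝ) 1) ∧ ∀ e ∉ G.edgeSet, z.2 e = 0} := by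
  classical
  have hK : IsCompact ((Set.univ.pi fun _ : W × W => Set.Icc (0 : ℝ) 1) ×ˢ
      (Set.univ.pi fun _ : Sym2 V => Set.Icc (0 : ℝ) 1)) :=
    (isCompact_univ_pi fun _ => isCompact_Icc).prod (isCompact_univ_pi fun _ => isCompact_Icc)
  refine hK.of_isClosed_subset ?_ ?_
  · refine IsClosed.inter ((D.isClosed_DCut isClosed_Icc).preimage continuous_fst)
      (IsClosed.inter ?_ (IsClosed.inter ?_ ?_))
    · change IsClosed {z : (W × W → ℝ) × (Sym2 V → ℝ) | _}
      simp only [Set.ofPred_forall]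
      refine isClosed_iInter fun v => isClosed_iInter fun w => isClosed_iInter fun _ => ?_
      exact isClosed_eq (by fun_prop) (by fun_prop)
    · change IsClosed {z : (W × W → ℝ) × (Sym2 V → ℝ) | _}
      simp only [Set.ofPred_forall]
      exact isClosed_iInter fun e => isClosed_iInter fun _ =>
        isClosed_Icc.preimage (by fun_prop : Continuous fun z : (W × W → ℝ) × (Sym2 V → ℝ) => z.2 e)
    · change IsClosed {z : (W × W → ℝ) × (Sym2 V → ℝ) | _}
      simp only [Set.ofPred_forall]
      refine isClosed_iInter fun e => isClosed_iInter fun _ => ?_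
      exact isClosed_eq (by fun_prop) (by fun_prop)
  · rintro ⟨x, y⟩ ⟨hx, -, hy, hy'⟩
    refine ⟨fun a _ => D.mem_Icc_of_mem_DCut hx a, fun e _ => ?_⟩
    by_cases he : e ∈ G.edgeSet
    · exact hy e he
    · have h0 : y e = 0 := hy' e he
      change y e ∈ _
      simp [h0]

end SAP

/-! ### Sums over the arcs of the transformed instances -/

theorem PCVertex.sum_univ {V T : Type*} [Fintype V] [Fintype T] (g : PCVertex V T → ℝ) :
    ∑ u, g u = ∑ v, g (.vert v) + ∑ t, g (.copy t) + g .root + g .hub := by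
  classical
  let e : (V ⊕ T) ⊕ (Unit ⊕ Unit) ≃ PCVertex V T :=
    { toFun := Sum.elim (Sum.elim .vert .copy) (Sum.elim (fun _ => .root) fun _ => .hub)
      invFun := fun u => match u with
        | .vert v => .inl (.inl v)
        | .copy t => .inl (.inr t)
        | .root => .inr (.inl ())
        | .hub => .inr (.inr ())
      left_inv := by rintro ((_ | _) | (_ | _)) <;> rfl
      right_inv := by rintro (_ | _ | _ | _) <;> rfl }
  rw [← e.sum_comp]
  simp [e, Fintype.sum_sum_type, add_assoc]

theorem RPCVertex.sum_univ {V T : Type*} [Fintype V] [Fintype T] (g : RPCVertex V T → ℝ) :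
    ∑ u, g u = ∑ v, g (.vert v) + ∑ t, g (.copy t) := by
  classical
  let e : V ⊕ T ≃ RPCVertex V T :=
    { toFun := Sum.elim .vert .copy
      invFun := fun u => match u with
        | .vert v => .inl v
        | .copy t => .inr t
      left_inv := by rintro (_ | _) <;> rfl
      right_inv := by rintro (_ | _) <;> rfl }
  rw [← e.sum_comp]
  simp [e, Fintype.sum_sum_type]

section ArcLemmas

variable {V : Type*}

@[simp] theorem pcArc_vert_vert {I : PCSTP V} {v w : V} :
    PCArc I (.vert v, .vert w) ↔ I.G.Adj v w :=
  ⟨fun h => by cases h; assumption, .edge⟩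

@[simp] theorem pcArc_vert_copy {I : PCSTP V} {v : V} {t : I.potTerminals} :
    PCArc I (.vert v, .copy t) ↔ v = t :=
  ⟨fun h => by cases h; rfl, fun h => h ▸ .toCopy t⟩

@[simp] theorem pcArc_vert_hub {I : PCSTP V} {v : V} :
    PCArc I (.vert v, .hub) ↔ v ∈ I.potTerminals :=
  ⟨fun h => by cases h with | toHub t => exact t.2, fun h => .toHub ⟨v, h⟩⟩

@[simp] theorem pcArc_root_vert {I : PCSTP V} {v : V} :
    PCArc I (.root, .vert v) ↔ v ∈ I.potTerminals :=
  ⟨fun h => by cases h with | fromRoot t => exact t.2, fun h => .fromRoot ⟨v, h⟩⟩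

@[simp] theorem pcArc_hub_copy {I : PCSTP V} {t : I.potTerminals} :
    PCArc I (.hub, .copy t) := .hubToCopy t

@[simp] theorem not_pcArc_vert_root {I : PCSTP V} {v : V} : ¬ PCArc I (.vert v, .root) := nofun
@[simp] theorem not_pcArc_copy {I : PCSTP V} {t : I.potTerminals} {u} :
    ¬ PCArc I (.copy t, u) := nofun
@[simp] theorem not_pcArc_hub_vert {I : PCSTP V} {v : V} : ¬ PCArc I (.hub, .vert v) := nofun
@[simp] theorem not_pcArc_hub_hub {I : PCSTP V} : ¬ PCArc I (.hub, .hub) := nofun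
@[simp] theorem not_pcArc_hub_root {I : PCSTP V} : ¬ PCArc I (.hub, .root) := nofun
@[simp] theorem not_pcArc_root_copy {I : PCSTP V} {t : I.potTerminals} :
    ¬ PCArc I (.root, .copy t) := nofun
@[simp] theorem not_pcArc_root_hub {I : PCSTP V} : ¬ PCArc I (.root, .hub) := nofun
@[simp] theorem not_pcArc_root_root {I : PCSTP V} : ¬ PCArc I (.root, .root) := nofun

@[simp] theorem rpcArc_vert_vert {J : RPCSTP V} {tp : J.fixed} {v w : V} :
    RPCArc J tp (.vert v, .vert w) ↔ J.G.Adj v w :=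
  ⟨fun h => by cases h; assumption, .edge⟩

@[simp] theorem rpcArc_vert_copy {J : RPCSTP V} {tp : J.fixed} {v : V} {t : J.free} :
    RPCArc J tp (.vert v, .copy t) ↔ v = t ∨ v = tp :=
  ⟨fun h => by cases h <;> simp, by
    rintro (h | h)
    · exact h ▸ .toCopy t
    · exact h ▸ .fixedToCopy t⟩

@[simp] theorem not_rpcArc_copy {J : RPCSTP V} {tp : J.fixed} {t : J.free} {u} :
    ¬ RPCArc J tp (.copy t, u) := nofun

open Classical in
-- Combined with `SAP.sum_inCut`, this evaluates both objective values and cut weights, one family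
-- of arcs at a time.
theorem PCSTP.sum_arcs [Fintype V] (I : PCSTP V)
    (F : PCVertex V I.potTerminals × PCVertex V I.potTerminals → ℝ) :
    ∑ a with a ∈ I.toSAP.arcs, F a =
      (∑ v, ∑ w, if I.G.Adj v w then F (.vert v, .vert w) else 0) +
      ∑ t : I.potTerminals, (F (.root, .vert t) + F (.vert t, .hub) + F (.vert t, .copy t) +
        F (.hub, .copy t)) := by
  have hs : ∀ g : V → ℝ, (∑ v, if v ∈ I.potTerminals then g v else 0) =
      ∑ t : I.potTerminals, g t := fun g => by
    rw [← Finset.sum_filter]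
    exact Finset.sum_subtype _ (by simp) _
  have hc : ∑ v : V, ∑ t : I.potTerminals, (if v = t then F (.vert v, .copy t) else 0) =
      ∑ t : I.potTerminals, F (.vert t, .copy t) := by
    rw [Finset.sum_comm]
    simp
  rw [Finset.sum_filter, Fintype.sum_prod_type]
  simp only [toSAP, Set.mem_ofPred_eq]
  simp only [PCVertex.sum_univ, pcArc_vert_vert, pcArc_vert_copy, pcArc_vert_hub, pcArc_root_vert,
    pcArc_hub_copy, not_pcArc_vert_root, not_pcArc_copy, not_pcArc_hub_vert, not_pcArc_hub_hub,
    not_pcArc_hub_root, not_pcArc_root_copy, not_pcArc_root_hub, not_pcArc_root_root, if_true,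
    if_false, Finset.sum_add_distrib, Finset.sum_const_zero, hc,
    hs fun v => F (.vert v, .hub), hs fun v => F (.root, .vert v)]
  ring

open Classical in
theorem RPCSTP.sum_arcs [Fintype V] (J : RPCSTP V) (tp tq : J.fixed)
    (F : RPCVertex V J.free × RPCVertex V J.free → ℝ) :
    ∑ a with a ∈ (J.toSAP tp tq).arcs, F a =
      (∑ v, ∑ w, if J.G.Adj v w then F (.vert v, .vert w) else 0) +
      ∑ t : J.free, (F (.vert t, .copy t) + F (.vert tp, .copy t)) := by
  have hc : ∑ v : V, ∑ t : J.free, (if v = t ∨ v = tp then F (.vert v, .copy t) else 0) =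
      ∑ t : J.free, (F (.vert t, .copy t) + F (.vert tp, .copy t)) := by
    rw [Finset.sum_comm]
    refine Finset.sum_congr rfl fun t _ => ?_
    -- A free terminal is never `tp`, so `(t, t')` and `(tp, t')` are distinct arcs and the
    -- disjunction splits into a sum.
    have hne : (t : V) ≠ tp := fun h => t.2.2 (h ▸ tp.2)
    have h : ∀ v : V, (if v = t ∨ v = tp then F (.vert v, .copy t) else 0) =
        (if v = t then F (.vert v, .copy t) else 0) +
          if v = tp then F (.vert v, .copy t) else 0 := fun v => by
      by_cases h₁ : v = t
      · simp [h₁, hne]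
      · simp [h₁]
    simp [h, Finset.sum_add_distrib]
  rw [Finset.sum_filter, Fintype.sum_prod_type]
  simp only [toSAP, Set.mem_ofPred_eq]
  simp only [RPCVertex.sum_univ, rpcArc_vert_vert, rpcArc_vert_copy, not_rpcArc_copy,
    if_false, Finset.sum_add_distrib, Finset.sum_const_zero, hc]
  ring

end ArcLemmas

/-! ### The rooted relaxation and its transfer to the unrooted one -/

namespace RPCSTP

variable {V : Type*} [Fintype V] (J : RPCSTP V)

open Classical in
/-- The arc vector that selects the arcs `(v, w)` with `R v w` and all arcs `(t, t')`. -/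
noncomputable def selectArcs (R : V → V → Prop) : RPCVertex V J.free × RPCVertex V J.free → ℝ
  | (.vert v, .vert w) => if R v w then 1 else 0
  | (.vert v, .copy t) => if v = t then 1 else 0
  | _ => 0

/-- The edge vector belonging to `selectArcs`. -/
noncomputable def selectEdges (R : V → V → Prop) : Sym2 V → ℝ :=
  Sym2.lift ⟨fun v w => J.selectArcs R (.vert v, .vert w) + J.selectArcs R (.vert w, .vert v),
    fun _ _ => add_comm _ _⟩

/-- Selecting arcs along which a level function `d` increases by one is feasible, provided that
every vertex other than the root of a set `K` containing all terminals is entered from `K`. -/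
theorem select_mem_prizeRCut (tp tq : J.fixed) {R : V → V → Prop} {d : V → ℕ} {K : Set V}
    (hadj : ∀ v w, R v w → J.G.Adj v w) (hd : ∀ v w, R v w → d w = d v + 1)
    (hfix : J.fixed ⊆ K) (hfree : J.free ⊆ K) (hK : ∀ w ∈ K, w ≠ tq → ∃ v ∈ K, R v w) :
    (J.selectArcs R, J.selectEdges R) ∈ J.prizeRCut tp tq (Set.Icc 0 1) := by
  classical
  have h01 : ∀ a, J.selectArcs R a ∈ Set.Icc (0 : ℝ) 1 := by
    rintro ⟨_ | _, _ | _⟩ <;> simp only [selectArcs] <;> (try split_ifs) <;> simp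
  refine ⟨⟨?_, fun a _ => h01 a, ?_⟩, fun v w _ => by simp [selectEdges], ?_, ?_⟩
  · rintro U hr ⟨u, huU, hu⟩
    -- From a vertex of `K` in `U`, step back along selected arcs. The level drops each time and the
    -- root lies outside `U`, so some selected arc enters `U`.
    have key : ∀ n w, d w = n → w ∈ K → RPCVertex.vert w ∈ U →
        1 ≤ ∑ a with a ∈ (J.toSAP tp tq).inCut U, J.selectArcs R a := by
      intro n
      induction n using Nat.strong_induction_on with
      | _ n ih =>
        intro w hw hwK hwU
        obtain ⟨v, hvK, hvw⟩ := hK w hwK (by rintro rfl; exact hr hwU)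
        by_cases hv : RPCVertex.vert v ∈ U
        · exact ih (d v) (by have := hd v w hvw; omega) v rfl hvK hv
        · refine le_trans ?_ ((J.toSAP tp tq).le_sum_inCut (fun a _ => (h01 a).1)
            (a := (.vert v, .vert w)) (.edge (hadj v w hvw)) hv hwU)
          simp [selectArcs, hvw]
    rcases hu with ⟨t, rfl⟩ | ⟨w, hw, rfl⟩
    · by_cases ht : RPCVertex.vert (t : V) ∈ U
      · exact key _ t rfl (hfree t.2) ht
      · refine le_trans ?_ ((J.toSAP tp tq).le_sum_inCut (fun a _ => (h01 a).1)
          (a := (.vert t, .copy t)) (.toCopy t) ht huU)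
        simp [selectArcs]
    · exact key _ w rfl (hfix hw) huU
  · rintro ⟨v | t, w | s⟩ ha
    · have : ¬ R v w := fun h => ha (.edge (hadj v w h))
      simp [selectArcs, this]
    · have : v ≠ s := by
        rintro rfl
        exact ha (.toCopy s)
      simp [selectArcs, this]
    · rfl
    · rfl
  · intro e
    induction e with | _ v w
    intro _
    -- Levels rule out selecting both orientations of an edge, which keeps `y ≤ 1`.
    have h : R v w → ¬ R w v := fun h h' => by
      have := hd _ _ h
      have := hd _ _ h'
      omega
    by_cases h1 : R v w
    · simp [selectEdges, selectArcs, h1, h h1]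
    · by_cases h2 : R w v <;> simp [selectEdges, selectArcs, h1, h2]
  · intro e
    induction e with | _ v w
    intro he
    have h1 : ¬ R v w := fun h => he (hadj v w h)
    have h2 : ¬ R w v := fun h => he (hadj w v h).symm
    simp [selectEdges, selectArcs, h1, h2]

/-- All arcs that increase the distance from `tq` are selected; the predecessor of a vertex is its
neighbour on a shortest path to `tq`. -/
theorem prizeRCut_nonempty (tp tq : J.fixed) : (J.prizeRCut tp tq (Set.Icc 0 1)).Nonempty := by
  refine ⟨_, J.select_mem_prizeRCut tp tq (K := Set.univ) (d := J.G.dist tq)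
    (R := fun v w => J.G.Adj v w ∧ J.G.dist tq w = J.G.dist tq v + 1)
    (fun _ _ h => h.1) (fun _ _ h => h.2) (Set.subset_univ _) (Set.subset_univ _) ?_⟩
  intro w _ hw
  obtain ⟨p, hp⟩ := J.connected.exists_walk_length_eq_dist w tq
  cases p with
  | nil => exact absurd rfl hw
  | @cons _ v _ h p =>
    refine ⟨v, trivial, h.symm, ?_⟩
    rw [SimpleGraph.Walk.length_cons, SimpleGraph.dist_comm] at hp
    have h1 := SimpleGraph.dist_le p
    rw [SimpleGraph.dist_comm] at h1
    have h2 := J.connected.dist_triangle (u := (tq : V)) (v := v) (w := w)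
    rw [SimpleGraph.dist_eq_one_iff_adj.2 h.symm] at h2
    omega

theorem isLeast_vLPPrizeRCut (tp tq : J.fixed) :
    IsLeast (J.prizeRCutLPValues tp tq) (J.vLPPrizeRCut tp tq) := by
  refine IsCompact.isLeast_sInf ?_ ((J.prizeRCut_nonempty tp tq).image _)
  exact ((J.toSAP tp tq).isCompact_edgeFormulation J.G .vert).image
    ((J.toSAP tp tq).continuous_value.comp continuous_fst)

/-- A potential terminal that is not fixed, as an element of `J.free`. -/
def toFree (t : J.potTerminals) (h : (t : V) ∉ J.fixed) : J.free := ⟨t, t.2, h⟩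

open Classical in
/-- The point of PrizeCut obtained from a point of PrizeRCut by sending one unit of flow from the
artificial root to `tq` and one unit from `tp` to `v₀'`. -/
noncomputable def unrootArcs (tp tq : J.fixed)
    (x : RPCVertex V J.free × RPCVertex V J.free → ℝ) :
    PCVertex V J.potTerminals × PCVertex V J.potTerminals → ℝ
  | (.vert v, .vert w) => x (.vert v, .vert w)
  | (.root, .vert v) => if v = tq then 1 else 0
  | (.vert v, .hub) => if v = tp then 1 else 0
  | (.vert v, .copy t) =>
    if v = t then if h : (t : V) ∉ J.fixed then x (.vert t, .copy (J.toFree t h)) else 1 else 0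
  | (.hub, .copy t) => if h : (t : V) ∉ J.fixed then x (.vert tp, .copy (J.toFree t h)) else 0
  | _ => 0

open Classical in
-- Extension by zero puts both instances over the same index set, so their values and cuts can be
-- compared term by term.
theorem sum_free (g : J.free → ℝ) :
    ∑ t : J.free, g t =
      ∑ t : J.potTerminals, if h : (t : V) ∉ J.fixed then g (J.toFree t h) else 0 := by
  refine Finset.sum_of_injOn (fun t : J.free => (⟨t, t.2.1⟩ : J.potTerminals)) ?_ ?_ ?_ ?_
  · intro s _ t _ h
    exact Subtype.ext (congrArg (fun u : J.potTerminals => (u : V)) h)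
  · simp
  · intro t _ ht
    refine dif_neg fun h => ht ⟨J.toFree t h, by simp, rfl⟩
  · intro t _
    rw [dif_pos t.2.2]
    rfl

/-- The unit on `(r', tq)` costs `M`, the other new units are free, and `(v₀', t')` has the same
price `p(t)` as `(tp, t')`. -/
theorem value_unrootArcs (tp tq : J.fixed) (hfix : J.fixed ⊆ J.potTerminals)
    (x : RPCVertex V J.free × RPCVertex V J.free → ℝ) :
    J.toPCSTP.toSAP.value (J.unrootArcs tp tq x) - J.bigM = (J.toSAP tp tq).value x := by
  classical
  have htq : ∑ t : J.potTerminals, (if (t : V) = tq then J.bigM else 0) = J.bigM := by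
    rw [Finset.sum_eq_single (⟨tq, hfix tq.2⟩ : J.potTerminals)]
    · simp
    · rintro t - ht
      exact if_neg fun h => ht (Subtype.ext h)
    · simp
  unfold SAP.value
  rw [J.toPCSTP.sum_arcs, J.sum_arcs, sum_free, sub_eq_iff_eq_add, add_assoc]
  refine congrArg₂ (· + ·) rfl ?_
  rw [← htq, ← Finset.sum_add_distrib]
  refine Finset.sum_congr rfl fun t _ => ?_
  by_cases ht : (t : V) ∈ J.fixed
  · simp [PCSTP.toSAP, PCSTP.sapCost, unrootArcs, ht]
  · have h1 : (t : V) ≠ tp := fun h => ht (h ▸ tp.2)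
    have h2 : (t : V) ≠ tq := fun h => ht (h ▸ tq.2)
    simp [PCSTP.toSAP, PCSTP.sapCost, toSAP, sapCost, unrootArcs, ht, h1, h2, toFree]

theorem unroot_mem_prizeCut (tp tq : J.fixed) (hfix : J.fixed ⊆ J.potTerminals)
    {x : RPCVertex V J.free × RPCVertex V J.free → ℝ} {y : Sym2 V → ℝ}
    (h : (x, y) ∈ J.prizeRCut tp tq (Set.Icc 0 1)) :
    (J.unrootArcs tp tq x, y) ∈ J.toPCSTP.prizeCut (Set.Icc 0 1) := by
  classical
  obtain ⟨⟨hcut, hx, hx0⟩, hy⟩ := h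
  have hxI := (J.toSAP tp tq).mem_Icc_of_mem_DCut ⟨hcut, hx, hx0⟩
  have h01 : ∀ a, J.unrootArcs tp tq x a ∈ Set.Icc (0 : ℝ) 1 := by
    rintro ⟨_ | _ | _ | _, _ | _ | _ | _⟩ <;> simp only [unrootArcs] <;> (try split_ifs) <;>
      first | exact hxI _ | simp
  refine ⟨⟨?_, fun a _ => h01 a, ?_⟩, hy⟩
  · rintro U hr ⟨u, huU, hu⟩
    -- In a violated cut no arc of value 1 enters `U`. This determines how `U` meets `tq`, `tp`,
    -- `v₀'` and the fixed copies.
    by_contra! hlt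
    have hlt' : ∀ a ∈ J.toPCSTP.toSAP.arcs, a.1 ∉ U → a.2 ∈ U →
        J.unrootArcs tp tq x a < 1 := fun a ha h1 h2 =>
      (J.toPCSTP.toSAP.le_sum_inCut (fun a _ => (h01 a).1) ha h1 h2).trans_lt hlt
    have hq : PCVertex.vert (tq : V) ∉ U := fun h => by
      have := hlt' (.root, .vert tq) (pcArc_root_vert.2 (hfix tq.2)) hr h
      simp [unrootArcs] at this
    have hp : PCVertex.hub ∈ U → PCVertex.vert (tp : V) ∈ U := fun h => by
      by_contra h'
      have := hlt' (.vert tp, .hub) (pcArc_vert_hub.2 (hfix tp.2)) h' h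
      simp [unrootArcs] at this
    have hc : ∀ t : J.potTerminals, (t : V) ∈ J.fixed → PCVertex.copy t ∈ U →
        PCVertex.vert (t : V) ∈ U := fun t ht h => by
      by_contra h'
      have := hlt' _ (.toCopy t) h' h
      simp [unrootArcs, ht] at this
    -- The rooted vertices embed into the unrooted ones, missing `r'`, `v₀'` and the copies of fixed
    -- terminals. If `U` contains a fixed copy, then by `hc` it contains the fixed terminal itself,
    -- so the preimage of `U` still meets the terminals.
    let ι : RPCVertex V J.free → PCVertex V J.potTerminals := fun u => match u with
      | .vert v => .vert v
      | .copy t => .copy ⟨t, t.2.1⟩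
    have hU : 1 ≤ ∑ a with a ∈ (J.toSAP tp tq).inCut (ι ⁻¹' U), x a := by
      refine hcut _ hq ?_
      rcases hu with rfl | ⟨t, rfl⟩
      · exact absurd huU hr
      · by_cases ht : (t : V) ∈ J.fixed
        · exact ⟨.vert t, hc t ht huU, Or.inr ⟨t, ht, rfl⟩⟩
        · exact ⟨.copy ⟨t, t.2, ht⟩, huU, Or.inl ⟨_, rfl⟩⟩
    refine absurd (hU.trans ?_) hlt.not_ge
    rw [SAP.sum_inCut, SAP.sum_inCut, J.toPCSTP.sum_arcs, J.sum_arcs, sum_free]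
    refine add_le_add le_rfl (Finset.sum_le_sum fun t _ => ?_)
    have h0 : ∀ a : PCVertex V J.potTerminals × PCVertex V J.potTerminals,
        0 ≤ if a.1 ∉ U ∧ a.2 ∈ U then J.unrootArcs tp tq x a else 0 := fun a => by
      split_ifs
      exacts [(h01 a).1, le_rfl]
    by_cases ht : (t : V) ∈ J.fixed
    · rw [dif_neg (not_not.2 ht)]
      exact add_nonneg (add_nonneg (add_nonneg (h0 (_, _)) (h0 (_, _))) (h0 (_, _))) (h0 (_, _))
    · rw [dif_pos ht]
      refine add_le_add (le_add_of_nonneg_of_le (add_nonneg (h0 (_, _)) (h0 (_, _))) ?_) ?_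
      · simp [unrootArcs, ht, ι, toFree]
      -- If `(tp, t')` enters the preimage, then `tp ∉ U`, so `v₀' ∉ U` by `hp`, and `(v₀', t')`
      -- enters `U` with the same value.
      · by_cases h1 : PCVertex.vert (tp : V) ∈ U
        · rw [if_neg fun h => h.1 h1]
          exact h0 (_, _)
        · have h2 : PCVertex.hub ∉ U := fun h => h1 (hp h)
          simp [unrootArcs, ht, ι, toFree, h1, h2]
  · rintro ⟨v | _ | _ | _, w | _ | _ | _⟩ ha <;> try rfl
    · exact hx0 _ fun h => ha (.edge (rpcArc_vert_vert.1 h))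
    · exact if_neg fun h => ha (pcArc_vert_copy.2 h)
    · refine if_neg ?_
      rintro rfl
      exact ha (pcArc_vert_hub.2 (hfix tp.2))
    · refine if_neg ?_
      rintro rfl
      exact ha (pcArc_root_vert.2 (hfix tq.2))
    · exact absurd (PCArc.hubToCopy _) ha

end RPCSTP

namespace PCSTP

variable {V : Type*} [Fintype V] (I : PCSTP V)

theorem isLeast_vLPPrizeCut (h : (I.prizeCut (Set.Icc 0 1)).Nonempty) :
    IsLeast I.prizeCutLPValues I.vLPPrizeCut := by
  refine IsCompact.isLeast_sInf ?_ (h.image _)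
  exact (I.toSAP.isCompact_edgeFormulation I.G .vert).image
    ((I.toSAP.continuous_value.comp continuous_fst).sub continuous_const)

end PCSTP

namespace RPCSTP

variable {V : Type*} [Fintype V] (J : RPCSTP V)

theorem prizeCut_nonempty (hfix : J.fixed ⊆ J.potTerminals) :
    (J.toPCSTP.prizeCut (Set.Icc 0 1)).Nonempty := by
  obtain ⟨t, ht⟩ := J.fixed_nonempty
  obtain ⟨⟨x, y⟩, h⟩ := J.prizeRCut_nonempty ⟨t, ht⟩ ⟨t, ht⟩
  exact ⟨_, J.unroot_mem_prizeCut _ _ hfix h⟩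

theorem vLPPrizeCut_le (tp tq : J.fixed) (hfix : J.fixed ⊆ J.potTerminals) :
    J.vLPPrizeCut ≤ J.vLPPrizeRCut tp tq := by
  obtain ⟨⟨x, y⟩, h, hv⟩ := (J.isLeast_vLPPrizeRCut tp tq).1
  refine (J.toPCSTP.isLeast_vLPPrizeCut (J.prizeCut_nonempty hfix)).2
    ⟨_, J.unroot_mem_prizeCut tp tq hfix h, ?_⟩
  rw [← hv]
  exact J.value_unrootArcs tp tq hfix x

end RPCSTP

/-! ### The wheel instance -/

/-- The edges of the wheel. -/
def wheelEdges : Finset (Sym2 (Fin 7)) :=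
  {s(0, 2), s(0, 4), s(0, 6), s(1, 2), s(2, 3), s(3, 4), s(4, 5), s(5, 6), s(6, 1)}

theorem wheelGraph_adj_iff (v w : Fin 7) : wheelGraph.Adj v w ↔
    s(v, w) ∈ wheelEdges := by
  simp only [wheelEdges, wheelGraph, SimpleGraph.fromEdgeSet_adj, Set.mem_insert_iff,
    Set.mem_singleton_iff, Finset.mem_insert, Finset.mem_singleton]
  revert v w
  decide

open Classical in
theorem sum_wheelGraph_adj (F : Fin 7 → Fin 7 → ℝ) :
    (∑ v, ∑ w, if wheelGraph.Adj v w then F v w else 0) =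
      F 0 2 + F 2 0 + F 0 4 + F 4 0 + F 0 6 + F 6 0 + F 1 2 + F 2 1 + F 2 3 + F 3 2 + F 3 4 +
        F 4 3 + F 4 5 + F 5 4 + F 5 6 + F 6 5 + F 6 1 + F 1 6 := by
  have h : ∀ v w, (if wheelGraph.Adj v w then F v w else 0) =
      if s(v, w) ∈ wheelEdges then F v w else 0 := fun v w =>
    if_congr (wheelGraph_adj_iff v w) rfl rfl
  simp only [h, Fin.sum_univ_seven]
  simp +decide only [if_true, if_false]
  ring

/-- The rooted wheel instance. -/
noncomputable abbrev rootedWheel (ε : ℝ) (hε : 0 < ε) : RPCSTP (Fin 7) :=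
  (wheel ε hε).rooted wheelFixed wheelFixed_nonempty

theorem mem_potTerminals_wheel {ε : ℝ} (hε : 0 < ε) (v : Fin 7) :
    v ∈ (wheel ε hε).potTerminals ↔ v ∈ wheelFixed := by
  change 0 < (![4, 4, 0, 4, ε, 4, 0] : Fin 7 → ℝ) v ↔ _
  fin_cases v <;> simp [wheelFixed, hε]

instance isEmpty_free_rootedWheel {ε : ℝ} (hε : 0 < ε) : IsEmpty (rootedWheel ε hε).free :=
  ⟨fun t => t.2.2 ((mem_potTerminals_wheel hε t).1 t.2.1)⟩

/-! ### The rooted relaxation of the wheel has value 8 -/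

section Rooted

variable {ε : ℝ} {hε : 0 < ε}

theorem rootedWheel_value (tp tq : (rootedWheel ε hε).fixed)
    (x : RPCVertex (Fin 7) (rootedWheel ε hε).free × RPCVertex (Fin 7) (rootedWheel ε hε).free → ℝ)
    {X : Fin 7 → Fin 7 → ℝ} (hX : ∀ v w, x (.vert v, .vert w) = X v w) :
    ((rootedWheel ε hε).toSAP tp tq).value x =
      X 0 2 + X 2 0 + X 0 4 + X 4 0 + X 0 6 + X 6 0 + 2 * (X 1 2 + X 2 1 + X 2 3 + X 3 2 + X 3 4 +
        X 4 3 + X 4 5 + X 5 4 + X 5 6 + X 6 5 + X 6 1 + X 1 6) := by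
  unfold SAP.value
  rw [RPCSTP.sum_arcs, Fintype.sum_empty (ι := (rootedWheel ε hε).free),
    add_zero]
  refine (sum_wheelGraph_adj fun v w => (if 0 ∈ s(v, w) then 1 else 2) * x (.vert v, .vert w)).trans
    ?_
  simp only [hX]
  simp +decide only [if_true, if_false]
  ring

theorem rootedWheel_cut {tp tq : (rootedWheel ε hε).fixed}
    {x : RPCVertex (Fin 7) (rootedWheel ε hε).free × RPCVertex (Fin 7) (rootedWheel ε hε).free → ℝ}
    (hx : ((rootedWheel ε hε).toSAP tp tq).CutConstraints x)
    {X : Fin 7 → Fin 7 → ℝ} (hX : ∀ v w, x (.vert v, .vert w) = X v w)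
    {q : Fin 7} (hq : (tq : Fin 7) = q) (U : Finset (Fin 7)) (hr : q ∉ U) {t : Fin 7}
    (ht : t ∈ wheelFixed) (htU : t ∈ U) :
    let Y := fun v w => if v ∉ U ∧ w ∈ U then X v w else 0
    1 ≤ Y 0 2 + Y 2 0 + Y 0 4 + Y 4 0 + Y 0 6 + Y 6 0 + Y 1 2 + Y 2 1 + Y 2 3 + Y 3 2 + Y 3 4 +
        Y 4 3 + Y 4 5 + Y 5 4 + Y 5 6 + Y 6 5 + Y 6 1 + Y 1 6 := by
  classical
  have h := hx (RPCVertex.vert '' (U : Set (Fin 7)))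
    (by rintro ⟨v, hv, h⟩; injection h with h; exact hr (hq ▸ h ▸ hv))
    ⟨.vert t, ⟨t, htU, rfl⟩, Or.inr ⟨t, ht, rfl⟩⟩
  rw [SAP.sum_inCut, RPCSTP.sum_arcs, Fintype.sum_empty (ι := (rootedWheel ε hε).free),
    add_zero] at h
  refine h.trans_eq ((sum_wheelGraph_adj fun v w => _).trans ?_)
  have hm : ∀ v, (RPCVertex.vert v : RPCVertex (Fin 7) (rootedWheel ε hε).free) ∈
      RPCVertex.vert '' (U : Set (Fin 7)) ↔ v ∈ U := fun v => by simp
  simp only [hm, hX]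

theorem rootedWheel_le_value {tp tq : (rootedWheel ε hε).fixed}
    {x : RPCVertex (Fin 7) (rootedWheel ε hε).free × RPCVertex (Fin 7) (rootedWheel ε hε).free → ℝ}
    (hx : x ∈ ((rootedWheel ε hε).toSAP tp tq).DCut (Set.Icc 0 1)) :
    8 ≤ ((rootedWheel ε hε).toSAP tp tq).value x := by
  obtain ⟨X, hX⟩ : ∃ X : Fin 7 → Fin 7 → ℝ, ∀ v w, x (.vert v, .vert w) = X v w :=
    ⟨_, fun _ _ => rfl⟩
  have h0 : ∀ v w, 0 ≤ X v w := fun v w => hX v w ▸ (SAP.mem_Icc_of_mem_DCut _ hx _).1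
  rw [rootedWheel_value tp tq x hX]
  have f0 : (0 : Fin 7) ∈ wheelFixed := by simp [wheelFixed]
  have f1 : (1 : Fin 7) ∈ wheelFixed := by simp [wheelFixed]
  have f3 : (3 : Fin 7) ∈ wheelFixed := by simp [wheelFixed]
  have f4 : (4 : Fin 7) ∈ wheelFixed := by simp [wheelFixed]
  have f5 : (5 : Fin 7) ∈ wheelFixed := by simp [wheelFixed]
  obtain ⟨q, hq⟩ := tq
  have hq' : q = 0 ∨ q = 1 ∨ q = 3 ∨ q = 4 ∨ q = 5 := hq
  have H := rootedWheel_cut hx.1 hX (q := q) rfl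
  have a1 := h0 0 2
  have a2 := h0 2 0
  have a3 := h0 0 4
  have a4 := h0 4 0
  have a5 := h0 0 6
  have a6 := h0 6 0
  have a7 := h0 1 2
  have a8 := h0 2 1
  have a9 := h0 2 3
  have a10 := h0 3 2
  have a11 := h0 3 4
  have a12 := h0 4 3
  have a13 := h0 4 5
  have a14 := h0 5 4
  have a15 := h0 5 6
  have a16 := h0 6 5
  have a17 := h0 6 1
  have a18 := h0 1 6
  rcases hq' with rfl | rfl | rfl | rfl | rfl
  · have b1 := H {4} (by decide) f4 (by decide)
    have b2 := H {1, 2} (by decide) f1 (by decide)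
    have b3 := H {1, 6} (by decide) f1 (by decide)
    have b4 := H {3} (by decide) f3 (by decide)
    have b5 := H {5} (by decide) f5 (by decide)
    have b6 := H {1} (by decide) f1 (by decide)
    simp +decide only [if_true, if_false] at b1 b2 b3 b4 b5 b6
    linarith
  · have b1 := H {4} (by decide) f4 (by decide)
    have b2 := H {0, 2, 6} (by decide) f0 (by decide)
    have b3 := H {0, 4, 5, 6} (by decide) f0 (by decide)
    have b4 := H {0, 2, 3, 4} (by decide) f0 (by decide)
    have b5 := H {3} (by decide) f3 (by decide)
    have b6 := H {5} (by decide) f5 (by decide)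
    simp +decide only [if_true, if_false] at b1 b2 b3 b4 b5 b6
    linarith
  · have b1 := H {0, 4} (by decide) f4 (by decide)
    have b2 := H {4} (by decide) f4 (by decide)
    have b3 := H {1, 2, 6} (by decide) f1 (by decide)
    have b4 := H {0, 2, 6} (by decide) f0 (by decide)
    have b5 := H {5} (by decide) f5 (by decide)
    have b6 := H {1} (by decide) f1 (by decide)
    simp +decide only [if_true, if_false] at b1 b2 b3 b4 b5 b6
    linarith
  -- For root `4` the weights are `1, 1, 2, 2, 2`, in the order listed.
  · have b1 := H {1, 2, 6} (by decide) f1 (by decide)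
    have b2 := H {0} (by decide) f0 (by decide)
    have b3 := H {3} (by decide) f3 (by decide)
    have b4 := H {5} (by decide) f5 (by decide)
    have b5 := H {1} (by decide) f1 (by decide)
    simp +decide only [if_true, if_false] at b1 b2 b3 b4 b5
    linarith
  · have b1 := H {0, 4, 6} (by decide) f4 (by decide)
    have b2 := H {4} (by decide) f4 (by decide)
    have b3 := H {1, 2, 6} (by decide) f1 (by decide)
    have b4 := H {3} (by decide) f3 (by decide)
    have b5 := H {0, 2} (by decide) f0 (by decide)
    have b6 := H {1} (by decide) f1 (by decide)
    simp +decide only [if_true, if_false] at b1 b2 b3 b4 b5 b6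
    linarith

/-- The levels of the vertices in the tree with edges `12, 20, 04, 43, 45`, rooted at `q`. -/
def wheelLevel (q : Fin 7) : Fin 7 → ℕ :=
  match q with
  | 0 => ![0, 2, 1, 2, 1, 2, 0]
  | 1 => ![2, 0, 1, 4, 3, 4, 0]
  | 3 => ![2, 4, 3, 0, 1, 2, 0]
  | 5 => ![2, 4, 3, 2, 1, 0, 0]
  | _ => ![1, 3, 2, 1, 0, 1, 0]

/-- The edges of an optimal tree of the wheel. -/
def wheelTreeEdges : Finset (Sym2 (Fin 7)) := {s(1, 2), s(0, 2), s(0, 4), s(3, 4), s(4, 5)}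

/-- The arcs of the tree with edges `12, 20, 04, 43, 45`, rooted at `q`. -/
def wheelTreeArc (q v w : Fin 7) : Prop :=
  s(v, w) ∈ wheelTreeEdges ∧
    wheelLevel q w = wheelLevel q v + 1

instance (q v w : Fin 7) : Decidable (wheelTreeArc q v w) := inferInstanceAs (Decidable (_ ∧ _))

theorem vLPPrizeRCut_rootedWheel (tp tq : (rootedWheel ε hε).fixed) :
    (rootedWheel ε hε).vLPPrizeRCut tp tq = 8 := by
  obtain ⟨q, hq⟩ := tq
  have hq' : q = 0 ∨ q = 1 ∨ q = 3 ∨ q = 4 ∨ q = 5 := hq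
  have hK : ∀ w, w ≠ 6 → w ≠ q → ∃ v, v ≠ 6 ∧ wheelTreeArc q v w := by
    clear hq
    rcases hq' with rfl | rfl | rfl | rfl | rfl <;> decide
  refine IsLeast.csInf_eq ⟨?_, ?_⟩
  · refine ⟨_, (rootedWheel ε hε).select_mem_prizeRCut tp ⟨q, hq⟩ (R := wheelTreeArc q)
      (d := wheelLevel q) (K := {v | v ≠ 6}) ?_ (fun v w h => h.2) ?_ ?_ hK, ?_⟩
    · intro v w h
      refine (wheelGraph_adj_iff v w).2 ?_
      have h1 := h.1
      clear h
      revert v w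
      decide
    · rintro v (rfl | rfl | rfl | rfl | rfl) <;> simp
    · exact fun t ht => (isEmpty_free_rootedWheel hε).elim ⟨t, ht⟩
    · dsimp only
      rw [rootedWheel_value tp ⟨q, hq⟩ _ (X := fun v w => if wheelTreeArc q v w then 1 else 0)
        fun v w => by simp only [RPCSTP.selectArcs]; congr]
      rcases hq' with rfl | rfl | rfl | rfl | rfl <;>
        · simp +decide only [if_true, if_false]
          norm_num
  · rintro _ ⟨⟨x, y⟩, h, rfl⟩
    exact rootedWheel_le_value h.1

end Rooted

/-! ### The unrooted relaxation of the wheel has value `15/2 + ε/2` -/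

section Unrooted

variable {ε : ℝ} {hε : 0 < ε}

theorem sum_potTerminals_wheel (g : Fin 7 → ℝ) :
    ∑ t : (wheel ε hε).potTerminals, g t = g 0 + g 1 + g 3 + g 4 + g 5 := by
  refine (Finset.sum_subtype ({0, 1, 3, 4, 5} : Finset (Fin 7))
    (fun v => by rw [mem_potTerminals_wheel]; simp [wheelFixed]) g).symm.trans ?_
  simp [add_assoc]

theorem bigM_wheel : (wheel ε hε).bigM = 16 + ε := by
  classical
  have h : (wheel ε hε).bigM = ∑ t : (wheel ε hε).potTerminals, (wheel ε hε).p t :=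
    Finset.sum_subtype _ (by simp) _
  rw [h, sum_potTerminals_wheel]
  simp [wheel]
  ring

/-- The coordinates of an arc vector of the transformed wheel, with the copies of the potential
terminals indexed by vertices. -/
structure WheelCoords (x : PCVertex (Fin 7) (wheel ε hε).potTerminals ×
    PCVertex (Fin 7) (wheel ε hε).potTerminals → ℝ)
    (X : Fin 7 → Fin 7 → ℝ) (R H C K : Fin 7 → ℝ) : Prop where
  edge : ∀ v w, x (.vert v, .vert w) = X v w
  fromRoot : ∀ v, x (.root, .vert v) = R v
  toHub : ∀ v, x (.vert v, .hub) = H v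
  toCopy : ∀ t : (wheel ε hε).potTerminals, x (.vert t, .copy t) = C t
  hubToCopy : ∀ t : (wheel ε hε).potTerminals, x (.hub, .copy t) = K t

variable {x : PCVertex (Fin 7) (wheel ε hε).potTerminals ×
    PCVertex (Fin 7) (wheel ε hε).potTerminals → ℝ}
    {X : Fin 7 → Fin 7 → ℝ} {R H C K : Fin 7 → ℝ}

theorem wheel_value (h : WheelCoords x X R H C K) :
    (wheel ε hε).toSAP.value x =
      X 0 2 + X 2 0 + X 0 4 + X 4 0 + X 0 6 + X 6 0 + 2 * (X 1 2 + X 2 1 + X 2 3 + X 3 2 + X 3 4 +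
        X 4 3 + X 4 5 + X 5 4 + X 5 6 + X 6 5 + X 6 1 + X 1 6) +
      ((16 + ε) * (R 0 + R 1 + R 3 + R 4 + R 5) + 4 * (K 0 + K 1 + K 3 + K 5) + ε * K 4) := by
  unfold SAP.value
  rw [PCSTP.sum_arcs]
  refine congrArg₂ (· + ·) ?_ ?_
  · refine (sum_wheelGraph_adj fun v w => (if 0 ∈ s(v, w) then 1 else 2) *
      x (.vert v, .vert w)).trans ?_
    simp only [h.edge]
    simp +decide only [if_true, if_false]
    ring
  · simp only [PCSTP.toSAP, PCSTP.sapCost, h.fromRoot, h.toHub, h.toCopy, h.hubToCopy, bigM_wheel]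
    rw [sum_potTerminals_wheel fun t => (16 + ε) * R t + 0 * H t + 0 * C t + (wheel ε hε).p t * K t]
    simp [wheel]
    ring

open Classical in
-- Membership in `U` enters through decidable predicates, so the formula serves explicit sets, where
-- conditions are evaluated, as well as arbitrary sets.
theorem wheel_sum_inCut (h : WheelCoords x X R H C K)
    (U : Set (PCVertex (Fin 7) (wheel ε hε).potTerminals)) {u k : Fin 7 → Prop} {b : Prop}
    [DecidablePred u] [DecidablePred k] [Decidable b]
    (hu : ∀ v, PCVertex.vert v ∈ U ↔ u v) (hk : ∀ t, PCVertex.copy t ∈ U ↔ k t)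
    (hr : PCVertex.root ∉ U) (hb : PCVertex.hub ∈ U ↔ b) :
    let Y := fun v w => if ¬ u v ∧ u w then X v w else 0
    let R' := fun v => if u v then R v else 0
    let H' := fun v => if ¬ u v ∧ b then H v else 0
    let C' := fun v => if ¬ u v ∧ k v then C v else 0
    let K' := fun v => if ¬ b ∧ k v then K v else 0
    ∑ a with a ∈ (wheel ε hε).toSAP.inCut U, x a =
      Y 0 2 + Y 2 0 + Y 0 4 + Y 4 0 + Y 0 6 + Y 6 0 + Y 1 2 + Y 2 1 + Y 2 3 + Y 3 2 + Y 3 4 +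
        Y 4 3 + Y 4 5 + Y 5 4 + Y 5 6 + Y 6 5 + Y 6 1 + Y 1 6 +
      (R' 0 + H' 0 + C' 0 + K' 0 + (R' 1 + H' 1 + C' 1 + K' 1) + (R' 3 + H' 3 + C' 3 + K' 3) +
        (R' 4 + H' 4 + C' 4 + K' 4) + (R' 5 + H' 5 + C' 5 + K' 5)) := by
  intro Y R' H' C' K'
  rw [SAP.sum_inCut, PCSTP.sum_arcs]
  refine congrArg₂ (· + ·) ((sum_wheelGraph_adj fun v w => _).trans ?_) ?_
  · simp only [hu, h.edge, Y]
  · rw [← sum_potTerminals_wheel (ε := ε) (hε := hε) fun t => R' t + H' t + C' t + K' t]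
    refine Finset.sum_congr rfl fun t _ => ?_
    simp only [hu, hk, hb, hr, h.fromRoot, h.toHub, h.toCopy, h.hubToCopy, not_false_eq_true,
      true_and, R', H', C', K']

theorem wheel_cut (hx : (wheel ε hε).toSAP.CutConstraints x) (h : WheelCoords x X R H C K)
    (U : Finset (Fin 7)) (b : Bool) {k : Fin 7} (hk : k ∈ wheelFixed) :
    let Y := fun v w => if ¬ v ∈ U ∧ w ∈ U then X v w else 0
    let R' := fun v => if v ∈ U then R v else 0
    let H' := fun v => if ¬ v ∈ U ∧ b then H v else 0
    let C' := fun v => if ¬ v ∈ U ∧ v = k then C v else 0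
    let K' := fun v => if ¬ b ∧ v = k then K v else 0
    1 ≤ Y 0 2 + Y 2 0 + Y 0 4 + Y 4 0 + Y 0 6 + Y 6 0 + Y 1 2 + Y 2 1 + Y 2 3 + Y 3 2 + Y 3 4 +
        Y 4 3 + Y 4 5 + Y 5 4 + Y 5 6 + Y 6 5 + Y 6 1 + Y 1 6 +
      (R' 0 + H' 0 + C' 0 + K' 0 + (R' 1 + H' 1 + C' 1 + K' 1) + (R' 3 + H' 3 + C' 3 + K' 3) +
        (R' 4 + H' 4 + C' 4 + K' 4) + (R' 5 + H' 5 + C' 5 + K' 5)) := by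
  let U' : Set (PCVertex (Fin 7) (wheel ε hε).potTerminals) := fun a => match a with
    | .vert v => v ∈ U
    | .copy t => (t : Fin 7) = k
    | .root => False
    | .hub => b
  refine (hx U' id ⟨.copy ⟨k, (mem_potTerminals_wheel hε k).2 hk⟩, rfl, Or.inr ⟨_, rfl⟩⟩).trans_eq
    ?_
  exact wheel_sum_inCut h U' (u := fun v => v ∈ U) (k := fun v => v = k) (b := b)
    (fun _ => Iff.rfl) (fun _ => Iff.rfl) id Iff.rfl

theorem exists_wheelCoords (hx : x ∈ (wheel ε hε).toSAP.DCut (Set.Icc 0 1)) :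
    ∃ X R H C K, WheelCoords x X R H C K ∧ (∀ v w, 0 ≤ X v w) ∧ (∀ v, 0 ≤ R v) ∧
      (∀ v, 0 ≤ H v) ∧ (∀ v, 0 ≤ C v) ∧ ∀ v, 0 ≤ K v := by
  classical
  have h0 := fun a => (SAP.mem_Icc_of_mem_DCut _ hx a).1
  -- The vertices `2` and `6` have no copy; their coordinates in `C` and `K` are set to 0.
  refine ⟨_, _, _, fun v => if h : v ∈ (wheel ε hε).potTerminals then
      x (.vert v, .copy ⟨v, h⟩) else 0,
    fun v => if h : v ∈ (wheel ε hε).potTerminals then x (.hub, .copy ⟨v, h⟩) else 0,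
    ⟨fun _ _ => rfl, fun _ => rfl, fun _ => rfl, fun t => by rw [dif_pos t.2],
      fun t => by rw [dif_pos t.2]⟩, fun _ _ => h0 _, fun _ => h0 _, fun _ => h0 _, fun v => ?_,
    fun v => ?_⟩
  all_goals
    dsimp only
    split_ifs
    exacts [h0 _, le_rfl]

theorem le_wheel_value (hε1 : ε < 1) (hx : x ∈ (wheel ε hε).toSAP.DCut (Set.Icc 0 1)) :
    15 / 2 + ε / 2 ≤ (wheel ε hε).toSAP.value x - (wheel ε hε).bigM := by
  obtain ⟨X, R, H, C, K, h, hX, hR, hH, hC, hK⟩ := exists_wheelCoords hx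
  have cut := wheel_cut hx.1 h
  rw [wheel_value h, bigM_wheel]
  have f0 : (0 : Fin 7) ∈ wheelFixed := by simp [wheelFixed]
  have f1 : (1 : Fin 7) ∈ wheelFixed := by simp [wheelFixed]
  have f3 : (3 : Fin 7) ∈ wheelFixed := by simp [wheelFixed]
  have f4 : (4 : Fin 7) ∈ wheelFixed := by simp [wheelFixed]
  have f5 : (5 : Fin 7) ∈ wheelFixed := by simp [wheelFixed]
  have x0 := hX 0 2
  have x1 := hX 2 0
  have x2 := hX 0 4
  have x3 := hX 4 0
  have x4 := hX 0 6
  have x5 := hX 6 0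
  have x6 := hX 1 2
  have x7 := hX 2 1
  have x8 := hX 2 3
  have x9 := hX 3 2
  have x10 := hX 3 4
  have x11 := hX 4 3
  have x12 := hX 4 5
  have x13 := hX 5 4
  have x14 := hX 5 6
  have x15 := hX 6 5
  have x16 := hX 6 1
  have x17 := hX 1 6
  have r0 := hR 0
  have h0 := hH 0
  have c0 := hC 0
  have k0 := hK 0
  have r1 := hR 1
  have h1 := hH 1
  have c1 := hC 1
  have k1 := hK 1
  have r3 := hR 3
  have h3 := hH 3
  have c3 := hC 3
  have k3 := hK 3
  have r4 := hR 4
  have h4 := hH 4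
  have c4 := hC 4
  have k4 := hK 4
  have r5 := hR 5
  have h5 := hH 5
  have c5 := hC 5
  have k5 := hK 5
  have b0 := cut {2, 3} false f3
  have b1 := cut {0, 2, 3, 4, 6} false f0
  have b2 := cut {0, 2, 3, 4} false f3
  have b3 := cut {1, 2} false f1
  have b4 := cut {4, 5} false f5
  have b5 := cut {0, 4, 5, 6} false f5
  have b6 := cut {1, 6} false f1
  have b7 := cut {3, 4} false f3
  have b8 := cut {0, 1, 2, 6} false f1
  have b9 := cut {3} false f3
  have b10 := cut {5, 6} false f5
  have b11 := cut {0, 1, 2, 4, 6} false f0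
  have b12 := cut {5} false f5
  have b13 := cut {1} false f1
  have b14 := cut {0, 2} false f0
  have b15 := cut {0, 1, 2, 3, 4, 5, 6} false f0
  have b16 := cut {0, 1, 2, 3, 4, 5, 6} false f1
  have b17 := cut {0, 1, 2, 3, 4, 5, 6} false f3
  -- With all vertices and `v₀'` inside, only arcs from `r'` enter: their total is at least 1, which
  -- accounts for `M`.
  have b18 := cut {0, 1, 2, 3, 4, 5, 6} true f0
  have b19 := cut {0, 2, 6} false f0
  have b20 := cut {0, 1, 2, 3, 4, 5, 6} false f5
  have b21 := cut {4} false f4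
  simp +decide only [if_true, if_false]
    at b0 b1 b2 b3 b4 b5 b6 b7 b8 b9 b10 b11 b12 b13 b14 b15 b16 b17 b18 b19 b20 b21
  -- `e0` and `e1` are the objective bounds at `ε = 0` and `ε = 1`; weighting them by `1 - ε` and
  -- `ε` gives the claim.
  have e0 : 15 / 2 ≤
      X 0 2 + X 2 0 + X 0 4 + X 4 0 + X 0 6 + X 6 0 + 2 * (X 1 2 + X 2 1 + X 2 3 + X 3 2 + X 3 4 +
        X 4 3 + X 4 5 + X 5 4 + X 5 6 + X 6 5 + X 6 1 + X 1 6) +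
      (16 * (R 0 + R 1 + R 3 + R 4 + R 5) + 4 * (K 0 + K 1 + K 3 + K 5)) - 16 := by
    linarith
  have e1 : 8 ≤
      X 0 2 + X 2 0 + X 0 4 + X 4 0 + X 0 6 + X 6 0 + 2 * (X 1 2 + X 2 1 + X 2 3 + X 3 2 + X 3 4 +
        X 4 3 + X 4 5 + X 5 4 + X 5 6 + X 6 5 + X 6 1 + X 1 6) +
      (17 * (R 0 + R 1 + R 3 + R 4 + R 5) + 4 * (K 0 + K 1 + K 3 + K 5) + K 4) - 17 := by
    linarith
  have g0 := mul_le_mul_of_nonneg_left e0 (sub_nonneg.2 hε1.le)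
  have g1 := mul_le_mul_of_nonneg_left e1 hε.le
  linarith

/-- The half-integral arcs of the optimal solution of the relaxation. -/
def wheelHalfArcs : Finset (Fin 7 × Fin 7) :=
  {(2, 0), (4, 0), (0, 6), (2, 1), (3, 2), (4, 3), (5, 4), (6, 5), (6, 1)}

/-- An optimal solution of the relaxation of PrizeCut for the wheel. -/
noncomputable def wheelPoint (ε : ℝ) (hε : 0 < ε) :
    PCVertex (Fin 7) (wheel ε hε).potTerminals × PCVertex (Fin 7) (wheel ε hε).potTerminals → ℝ
  | (.vert v, .vert w) => if (v, w) ∈ wheelHalfArcs then 1 / 2 else 0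
  | (.root, .vert v) => if v = 3 ∨ v = 5 then 1 / 2 else 0
  | (.vert v, .hub) => if v = 5 then 1 / 2 else 0
  | (.vert v, .copy t) => if v = t then if v = 4 then 1 / 2 else 1 else 0
  | (.hub, .copy t) => if (t : Fin 7) = 4 then 1 / 2 else 0
  | _ => 0

theorem wheelPoint_coords : WheelCoords (wheelPoint ε hε)
    (fun v w => if (v, w) ∈ wheelHalfArcs then 1 / 2 else 0)
    (fun v => if v = 3 ∨ v = 5 then 1 / 2 else 0) (fun v => if v = 5 then 1 / 2 else 0)
    (fun v => if v = 4 then 1 / 2 else 1) (fun v => if v = 4 then 1 / 2 else 0) :=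
  ⟨fun _ _ => rfl, fun _ => rfl, fun _ => rfl, fun _ => if_pos rfl, fun _ => rfl⟩

theorem wheelPoint_mem_Icc (a) : wheelPoint ε hε a ∈ Set.Icc (0 : ℝ) 1 := by
  obtain ⟨_ | _ | _ | _, _ | _ | _ | _⟩ := a <;> simp only [wheelPoint] <;> (try split_ifs) <;>
    norm_num

/-- What an arc of capacity `c` contributes to a cut bounds `c` times the jump of the indicator of
`U` along it. Summed along a path, the jumps telescope. -/
theorem ite_cut_bound (p q : Prop) [Decidable p] [Decidable q] {c : ℝ} (hc : 0 ≤ c) :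
    0 ≤ (if ¬ p ∧ q then c else 0) ∧
      c * ((if q then 1 else 0) - if p then 1 else 0) ≤ if ¬ p ∧ q then c else 0 := by
  by_cases p <;> by_cases q <;> simp [*]

/-- Each copy receives a unit flow made of two half-units, and weak max-flow min-cut applies. After
leaving `r'`, the halves reach `0` by `3,2,0` and `5,4,0`; `1` by `3,2,1` and `5,4,0,6,1`; `3`
directly and by `5,4,3`; `5` directly and by `3,2,0,6,5`. For `4`, both halves come together at `5`
in the same way; one continues through `4` to the copy and the other through `v₀'`. -/
theorem one_le_wheelPoint_cut (u k : Fin 7 → Prop) (b : Prop) [DecidablePred u] [DecidablePred k]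
    [Decidable b] {t : Fin 7} (ht : t ∈ wheelFixed) (hk : k t) :
    let Y := fun v w => if ¬ u v ∧ u w then (if (v, w) ∈ wheelHalfArcs then 1 / 2 else 0 : ℝ) else 0
    let R' := fun v => if u v then (if v = 3 ∨ v = 5 then 1 / 2 else 0 : ℝ) else 0
    let H' := fun v => if ¬ u v ∧ b then (if v = 5 then 1 / 2 else 0 : ℝ) else 0
    let C' := fun v => if ¬ u v ∧ k v then (if v = 4 then 1 / 2 else 1 : ℝ) else 0
    let K' := fun v => if ¬ b ∧ k v then (if v = 4 then 1 / 2 else 0 : ℝ) else 0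
    1 ≤ Y 0 2 + Y 2 0 + Y 0 4 + Y 4 0 + Y 0 6 + Y 6 0 + Y 1 2 + Y 2 1 + Y 2 3 + Y 3 2 + Y 3 4 +
        Y 4 3 + Y 4 5 + Y 5 4 + Y 5 6 + Y 6 5 + Y 6 1 + Y 1 6 +
      (R' 0 + H' 0 + C' 0 + K' 0 + (R' 1 + H' 1 + C' 1 + K' 1) + (R' 3 + H' 3 + C' 3 + K' 3) +
        (R' 4 + H' 4 + C' 4 + K' 4) + (R' 5 + H' 5 + C' 5 + K' 5)) := by
  have hR : ∀ v, (if u v then 1 / 2 else 0 : ℝ) = 1 / 2 * if u v then 1 else 0 := fun v => by simp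
  have hu : ∀ v, (0 : ℝ) ≤ if u v then 1 else 0 := fun v => by split_ifs <;> norm_num
  simp +decide only [if_true, if_false, ite_self]
  have r3 := hR 3
  have r5 := hR 5
  have u3 := hu 3
  have u5 := hu 5
  have a0 := ite_cut_bound (u 2) (u 0) (c := 1 / 2) (by norm_num)
  have a1 := ite_cut_bound (u 4) (u 0) (c := 1 / 2) (by norm_num)
  have a2 := ite_cut_bound (u 0) (u 6) (c := 1 / 2) (by norm_num)
  have a3 := ite_cut_bound (u 2) (u 1) (c := 1 / 2) (by norm_num)
  have a4 := ite_cut_bound (u 3) (u 2) (c := 1 / 2) (by norm_num)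
  have a5 := ite_cut_bound (u 4) (u 3) (c := 1 / 2) (by norm_num)
  have a6 := ite_cut_bound (u 5) (u 4) (c := 1 / 2) (by norm_num)
  have a7 := ite_cut_bound (u 6) (u 5) (c := 1 / 2) (by norm_num)
  have a8 := ite_cut_bound (u 6) (u 1) (c := 1 / 2) (by norm_num)
  have a9 := ite_cut_bound (u 5) (b) (c := 1 / 2) (by norm_num)
  have a10 := ite_cut_bound (u 0) (k 0) (c := 1) (by norm_num)
  have a11 := ite_cut_bound (u 1) (k 1) (c := 1) (by norm_num)
  have a12 := ite_cut_bound (u 3) (k 3) (c := 1) (by norm_num)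
  have a13 := ite_cut_bound (u 5) (k 5) (c := 1) (by norm_num)
  have a14 := ite_cut_bound (u 4) (k 4) (c := 1 / 2) (by norm_num)
  have a15 := ite_cut_bound (b) (k 4) (c := 1 / 2) (by norm_num)
  have hk' : (if k t then 1 else 0 : ℝ) = 1 := if_pos hk
  rcases (ht : t = 0 ∨ t = 1 ∨ t = 3 ∨ t = 4 ∨ t = 5) with rfl | rfl | rfl | rfl | rfl <;>
    linarith [a0.1, a0.2, a1.1, a1.2, a2.1, a2.2, a3.1, a3.2, a4.1, a4.2, a5.1, a5.2, a6.1, a6.2,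
      a7.1, a7.2, a8.1, a8.2, a9.1, a9.2, a10.1, a10.2, a11.1, a11.2, a12.1, a12.2, a13.1, a13.2,
      a14.1, a14.2, a15.1, a15.2]

theorem wheelPoint_cut : (wheel ε hε).toSAP.CutConstraints (wheelPoint ε hε) := by
  classical
  rintro U hr ⟨_, htU, rfl | ⟨⟨t, ht⟩, rfl⟩⟩
  · exact absurd htU hr
  · rw [wheel_sum_inCut wheelPoint_coords U (u := fun v => PCVertex.vert v ∈ U)
      (k := fun v => ∃ h, PCVertex.copy ⟨v, h⟩ ∈ U) (b := PCVertex.hub ∈ U)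
      (fun _ => Iff.rfl) (fun s => ⟨fun h => ⟨s.2, h⟩, fun h => h.2⟩) hr Iff.rfl]
    exact one_le_wheelPoint_cut (fun v => PCVertex.vert v ∈ U)
      (fun v => ∃ h, PCVertex.copy ⟨v, h⟩ ∈ U) (PCVertex.hub ∈ U)
      ((mem_potTerminals_wheel hε t).1 ht)
      ⟨ht, htU⟩

theorem vLPPrizeCut_wheel (hε1 : ε < 1) : (wheel ε hε).vLPPrizeCut = 15 / 2 + ε / 2 := by
  refine IsLeast.csInf_eq ⟨?_, ?_⟩
  · refine ⟨(wheelPoint ε hε, fun e => if e ∈ wheelEdges then 1 / 2 else 0),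
      ⟨⟨wheelPoint_cut, fun a _ => wheelPoint_mem_Icc a, ?_⟩, ?_, ?_, ?_⟩, ?_⟩
    · rintro ⟨v | _ | _ | _, w | _ | _ | _⟩ ha <;> try rfl
      · refine if_neg fun h => ha (.edge ((wheelGraph_adj_iff v w).2 ?_))
        clear ha
        revert v w
        decide
      · exact if_neg fun h => ha (pcArc_vert_copy.2 h)
      · refine if_neg ?_
        rintro rfl
        exact ha (pcArc_vert_hub.2 ((mem_potTerminals_wheel hε _).2 (by simp [wheelFixed])))
      · refine if_neg ?_
        rintro (rfl | rfl) <;>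
          exact ha (pcArc_root_vert.2 ((mem_potTerminals_wheel hε _).2 (by simp [wheelFixed])))
      · exact absurd (PCArc.hubToCopy _) ha
    · intro v w h
      have h1 := (wheelGraph_adj_iff v w).1 h
      -- Exactly one orientation of each edge carries `1/2`, so `y = 1/2` on every edge.
      have h2 : (v, w) ∈ wheelHalfArcs ↔ (w, v) ∉ wheelHalfArcs := by
        clear h
        revert v w
        decide
      by_cases h3 : (w, v) ∈ wheelHalfArcs <;> simp [wheelPoint, h1, h2, h3]
    · intro e _
      dsimp only
      split_ifs <;> norm_num
    · intro e
      induction e with | _ v w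
      exact fun h => if_neg fun h' => h ((wheelGraph_adj_iff v w).2 h')
    · dsimp only
      rw [wheel_value wheelPoint_coords, bigM_wheel]
      simp +decide only [if_true, if_false]
      ring
  · rintro _ ⟨⟨x, y⟩, h, rfl⟩
    exact le_wheel_value hε1 h.1

end Unrooted

/-! ### An optimal tree of the wheel -/

theorem SimpleGraph.Subgraph.card_edgeSet_coe {V : Type*} {G : SimpleGraph V} (S : G.Subgraph) :
    Nat.card S.coe.edgeSet = Nat.card S.edgeSet := by
  rw [← S.image_coe_edgeSet_coe]
  exact (Nat.card_image_of_injective (Sym2.map.injective Subtype.val_injective) _).symm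

theorem SimpleGraph.Subgraph.exists_adj_of_preconnected_coe {V : Type*} {G : SimpleGraph V}
    {S : G.Subgraph} (h : S.coe.Preconnected) {v w : V} (hv : v ∈ S.verts) (hw : w ∈ S.verts)
    (hne : v ≠ w) : ∃ u, S.Adj v u := by
  have : Nontrivial S.verts := ⟨⟨v, hv⟩, ⟨w, hw⟩, fun h => hne (congrArg Subtype.val h)⟩
  obtain ⟨u, hu⟩ := h.exists_adj_of_nontrivial ⟨v, hv⟩
  exact ⟨u, hu⟩

section OptimalTree

variable {ε : ℝ} {hε : 0 < ε}

open Classical in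
-- Writing edge costs as 2 minus a hub indicator leaves, apart from `ε`, only integer counts, so the
-- bound below becomes integer arithmetic.
theorem wheel_treeCost (S : (wheel ε hε).G.Subgraph) :
    (wheel ε hε).treeCost S = 2 * (Nat.card S.edgeSet : ℝ) -
      ((Finset.univ.filter fun e => e ∈ S.edgeSet ∧ 0 ∈ e).card : ℝ) +
      (((if 0 ∈ S.verts then 0 else 4) + (if 1 ∈ S.verts then 0 else 4) +
        (if 3 ∈ S.verts then 0 else 4) + (if 5 ∈ S.verts then 0 else 4) : ℕ) +
        if 4 ∈ S.verts then 0 else ε) := by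
  unfold PCSTP.treeCost
  refine congrArg₂ (· + ·) ?_ ?_
  · have hc : ∀ e, (wheel ε hε).c e = 2 - if 0 ∈ e then 1 else 0 := fun e => by
      change (if 0 ∈ e then (1 : ℝ) else 2) = _
      split_ifs <;> norm_num
    simp only [hc, Finset.sum_sub_distrib, Finset.sum_const, nsmul_eq_mul, Finset.sum_boole,
      Finset.filter_filter]
    rw [Nat.card_eq_fintype_card, Fintype.card_subtype, mul_comm]
  · rw [Finset.sum_filter, Fin.sum_univ_seven]
    simp only [wheel, ite_not]
    push_cast
    simp
    ring

theorem wheel_subgraph_adj {S : (wheel ε hε).G.Subgraph} {v w : Fin 7} (h : S.Adj v w) :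
    s(v, w) ∈ wheelEdges := (wheelGraph_adj_iff v w).1 h.adj_sub

open Classical in
theorem card_hub_edges_le (S : (wheel ε hε).G.Subgraph) :
    (Finset.univ.filter fun e => e ∈ S.edgeSet ∧ 0 ∈ e).card ≤
      (if 2 ∈ S.verts then 1 else 0) + (if 4 ∈ S.verts then 1 else 0) +
        (if 6 ∈ S.verts then 1 else 0) := by
  have hsub : (Finset.univ.filter fun e => e ∈ S.edgeSet ∧ 0 ∈ e) ⊆
      (({2, 4, 6} : Finset (Fin 7)).filter (· ∈ S.verts)).image fun v => s(0, v) := by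
    intro e he
    obtain ⟨-, hS, v, rfl⟩ := Finset.mem_filter.1 he
    have h1 : s(0, v) ∈ wheelEdges := wheel_subgraph_adj hS
    refine Finset.mem_image.2 ⟨v, Finset.mem_filter.2 ⟨?_, S.edge_vert hS.symm⟩, rfl⟩
    clear he hS
    revert v
    decide
  refine (Finset.card_le_card hsub).trans (Finset.card_image_le.trans_eq ?_)
  rw [Finset.card_filter, Finset.sum_insert (by decide), Finset.sum_insert (by decide),
    Finset.sum_singleton, add_assoc]

open Classical in
theorem card_verts_eq (S : (wheel ε hε).G.Subgraph) :
    Nat.card S.verts = (if 0 ∈ S.verts then 1 else 0) + (if 1 ∈ S.verts then 1 else 0) +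
      (if 2 ∈ S.verts then 1 else 0) + (if 3 ∈ S.verts then 1 else 0) +
      (if 4 ∈ S.verts then 1 else 0) + (if 5 ∈ S.verts then 1 else 0) +
      (if 6 ∈ S.verts then 1 else 0) := by
  rw [Nat.card_eq_fintype_card, Fintype.card_subtype, Finset.card_filter, Fin.sum_univ_seven]

/-- Let a tree contain `a` of `0, 1, 3, 5` and `k` of `2, 4, 6`. It has `a + k - 1` edges if the
prize of `4` is left aside as a nonnegative term, at most `k` of them at the hub, so it costs at
least `14 - 2a + k`. This suffices for `a ≤ 3`. If `a = 4`, the neighbours of `1, 3, 5` force two of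
`2, 4, 6` into the tree, so `k ≥ 2`. -/
theorem le_wheel_treeCost {S : (wheel ε hε).G.Subgraph} (hS : S.coe.IsTree) :
    8 ≤ (wheel ε hε).treeCost S := by
  classical
  rw [wheel_treeCost]
  have hE := (SimpleGraph.isTree_iff_connected_and_card.1 hS).2
  rw [S.card_edgeSet_coe, card_verts_eq] at hE
  have hH := card_hub_edges_le S
  have hH0 : 0 ∉ S.verts → (Finset.univ.filter fun e => e ∈ S.edgeSet ∧ 0 ∈ e).card = 0 := by
    intro h0
    rw [Finset.card_eq_zero, Finset.filter_eq_empty_iff]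
    rintro e - ⟨he, v, rfl⟩
    exact h0 (S.edge_vert he)
  have hN : 0 < Nat.card S.verts := by
    obtain ⟨v⟩ := hS.connected.nonempty
    exact Nat.card_pos_iff.2 ⟨⟨v⟩, inferInstance⟩
  have hadj : ∀ v ∈ S.verts, 0 ∈ S.verts → v ≠ 0 → ∃ u ∈ S.verts, s(v, u) ∈ wheelEdges := by
    intro v hv h0 hne
    obtain ⟨u, hu⟩ := SimpleGraph.Subgraph.exists_adj_of_preconnected_coe
      hS.connected.preconnected hv h0 hne
    exact ⟨u, S.edge_vert hu.symm, wheel_subgraph_adj hu⟩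
  have h1 : 1 ∈ S.verts → 0 ∈ S.verts → 2 ∈ S.verts ∨ 6 ∈ S.verts := fun h h0 => by
    obtain ⟨u, hu, hu'⟩ := hadj 1 h h0 (by decide)
    have : u = 2 ∨ u = 6 := by clear hu; revert u; decide
    rcases this with rfl | rfl <;> simp [hu]
  have h3 : 3 ∈ S.verts → 0 ∈ S.verts → 2 ∈ S.verts ∨ 4 ∈ S.verts := fun h h0 => by
    obtain ⟨u, hu, hu'⟩ := hadj 3 h h0 (by decide)
    have : u = 2 ∨ u = 4 := by clear hu; revert u; decide
    rcases this with rfl | rfl <;> simp [hu]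
  have h5 : 5 ∈ S.verts → 0 ∈ S.verts → 4 ∈ S.verts ∨ 6 ∈ S.verts := fun h h0 => by
    obtain ⟨u, hu, hu'⟩ := hadj 5 h h0 (by decide)
    have : u = 4 ∨ u = 6 := by clear hu; revert u; decide
    rcases this with rfl | rfl <;> simp [hu]
  have hε0 : (0 : ℝ) ≤ if 4 ∈ S.verts then 0 else ε := by
    split_ifs
    exacts [le_rfl, hε.le]
  rw [card_verts_eq] at hN
  have key : 8 + (Finset.univ.filter fun e => e ∈ S.edgeSet ∧ 0 ∈ e).card ≤
      2 * Nat.card S.edgeSet + ((if 0 ∈ S.verts then 0 else 4) + (if 1 ∈ S.verts then 0 else 4) +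
        (if 3 ∈ S.verts then 0 else 4) + (if 5 ∈ S.verts then 0 else 4)) := by
    have hH1 : (Finset.univ.filter fun e => e ∈ S.edgeSet ∧ 0 ∈ e).card ≤
        3 * if 0 ∈ S.verts then 1 else 0 := by
      split_ifs with h0
      · refine hH.trans ?_
        split_ifs <;> norm_num
      · rw [hH0 h0]
    obtain ⟨n, hn⟩ : ∃ n : Fin 7 → ℕ, ∀ v, (if v ∈ S.verts then 1 else 0) = n v :=
      ⟨_, fun _ => rfl⟩
    have hn1 : ∀ v, n v ≤ 1 := fun v => by
      rw [← hn]
      split_ifs <;> norm_num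
    have hm : ∀ v, (if v ∈ S.verts then 0 else 4) = 4 - 4 * n v := fun v => by
      rw [← hn]
      split_ifs <;> norm_num
    -- The neighbour conditions become linear inequalities between 0/1 indicators, as `omega` needs.
    have hor : ∀ v u w, (v ∈ S.verts → 0 ∈ S.verts → u ∈ S.verts ∨ w ∈ S.verts) →
        n v + n 0 ≤ n u + n w + 1 := fun v u w h => by
      simp only [← hn]
      by_cases hv : v ∈ S.verts <;> by_cases h0 : 0 ∈ S.verts <;> by_cases hu : u ∈ S.verts <;>
        by_cases hw : w ∈ S.verts <;> simp_all
    have k1 := hor _ _ _ h1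
    have k3 := hor _ _ _ h3
    have k5 := hor _ _ _ h5
    simp only [hn] at hE hH hN hH1
    simp only [hm]
    have := hn1 0
    have := hn1 1
    have := hn1 3
    have := hn1 5
    omega
  have key' := (Nat.cast_le (α := ℝ)).2 key
  rw [Nat.cast_add, Nat.cast_add (2 * _), Nat.cast_mul] at key'
  push_cast at key' ⊢
  linarith

/-- The tree with edges `12, 20, 04, 43, 45`. -/
def wheelTree (ε : ℝ) (hε : 0 < ε) : (wheel ε hε).G.Subgraph where
  verts := {v | v ≠ 6}
  Adj v w := s(v, w) ∈ wheelTreeEdges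
  adj_sub {v w} h := (wheelGraph_adj_iff v w).2 (by revert v w; decide)
  edge_vert {v w} h := by
    change v ≠ 6
    revert v w
    decide
  symm := ⟨fun v w h => by rwa [Sym2.eq_swap]⟩

theorem card_edgeSet_wheelTree : Nat.card (wheelTree ε hε).edgeSet = 5 := by
  have h : (wheelTree ε hε).edgeSet = (wheelTreeEdges : Set (Sym2 (Fin 7))) := by
    ext e
    induction e with | _ v w
    rfl
  rw [h, Nat.card_eq_card_toFinset, Finset.toFinset_coe]
  rfl

theorem isTree_wheelTree : (wheelTree ε hε).coe.IsTree := by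
  refine SimpleGraph.isTree_iff_connected_and_card.2 ⟨?_, ?_⟩
  · have h0 : (0 : Fin 7) ∈ (wheelTree ε hε).verts := by change (0 : Fin 7) ≠ 6; decide
    have hadj : ∀ v w (hv : v ∈ (wheelTree ε hε).verts) (hw : w ∈ (wheelTree ε hε).verts),
        s(v, w) ∈ wheelTreeEdges → (wheelTree ε hε).coe.Reachable ⟨v, hv⟩ ⟨w, hw⟩ :=
      fun v w hv hw h => SimpleGraph.Adj.reachable (G := (wheelTree ε hε).coe) h
    have h2 : (2 : Fin 7) ∈ (wheelTree ε hε).verts := by change (2 : Fin 7) ≠ 6; decide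
    have h4 : (4 : Fin 7) ∈ (wheelTree ε hε).verts := by change (4 : Fin 7) ≠ 6; decide
    have r2 := hadj 0 2 h0 h2 (by decide)
    have r4 := hadj 0 4 h0 h4 (by decide)
    refine (SimpleGraph.connected_iff_exists_forall_reachable _).2 ⟨⟨0, h0⟩, ?_⟩
    rintro ⟨v, hv⟩
    fin_cases v
    · exact .refl _
    · exact r2.trans (hadj 2 1 h2 hv (by decide))
    · exact r2
    · exact r4.trans (hadj 4 3 h4 hv (by decide))
    · exact r4
    · exact r4.trans (hadj 4 5 h4 hv (by decide))
    · exact absurd rfl hv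
  · classical
    rw [SimpleGraph.Subgraph.card_edgeSet_coe, card_edgeSet_wheelTree, card_verts_eq]
    simp +decide [wheelTree]

theorem wheelTree_treeCost : (wheel ε hε).treeCost (wheelTree ε hε) = 8 := by
  classical
  have h : (Finset.univ.filter fun e => e ∈ (wheelTree ε hε).edgeSet ∧ 0 ∈ e) =
      {s(0, 2), s(0, 4)} := by
    ext e
    rw [Finset.mem_filter]
    induction e with | _ v w
    change _ ∧ s(v, w) ∈ wheelTreeEdges ∧ _ ↔ _
    revert v w
    decide
  rw [wheel_treeCost, card_edgeSet_wheelTree, h]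
  simp +decide [wheelTree]
  norm_num

theorem isOptimal_wheelTree : (wheel ε hε).IsOptimal (wheelTree ε hε) :=
  ⟨isTree_wheelTree, fun _ h => wheelTree_treeCost.trans_le (le_wheel_treeCost h)⟩

end OptimalTree

theorem mainTheorem4 :
    (∀ {V : Type*} [Fintype V] (I : PCSTP V) (T₀ : Set V) (hne : T₀.Nonempty),
      T₀ ⊆ I.potTerminals →
      (∃ S : I.G.Subgraph, I.IsOptimal S ∧ T₀ ⊆ S.verts) →
      ∀ tp tq : (I.rooted T₀ hne).fixed,
        IsLeast I.prizeCutLPValues I.vLPPrizeCut ∧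
        IsLeast ((I.rooted T₀ hne).prizeRCutLPValues tp tq)
          ((I.rooted T₀ hne).vLPPrizeRCut tp tq) ∧
        I.vLPPrizeCut ≤ (I.rooted T₀ hne).vLPPrizeRCut tp tq) ∧
    (∀ (ε : ℝ) (hε : 0 < ε), ε < 1 →
      wheelFixed ⊆ (wheel ε hε).potTerminals ∧
      (∃ S : (wheel ε hε).G.Subgraph, (wheel ε hε).IsOptimal S ∧ wheelFixed ⊆ S.verts) ∧
      (wheel ε hε).vLPPrizeCut = 15 / 2 + ε / 2 ∧
      (∀ tp tq : ((wheel ε hε).rooted wheelFixed wheelFixed_nonempty).fixed,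
        ((wheel ε hε).rooted wheelFixed wheelFixed_nonempty).vLPPrizeRCut tp tq = 8) ∧
      (15 / 2 + ε / 2 : ℝ) < 8) := by
  refine ⟨fun I T₀ hne hT _ tp tq => ?_, fun ε hε hε1 => ⟨?_, ?_, ?_, ?_, ?_⟩⟩
  · exact ⟨I.isLeast_vLPPrizeCut ((I.rooted T₀ hne).prizeCut_nonempty hT),
      (I.rooted T₀ hne).isLeast_vLPPrizeRCut tp tq, (I.rooted T₀ hne).vLPPrizeCut_le tp tq hT⟩
  · exact fun v hv => (mem_potTerminals_wheel hε v).2 hv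
  · refine ⟨wheelTree ε hε, isOptimal_wheelTree, ?_⟩
    rintro v (rfl | rfl | rfl | rfl | rfl) <;> simp [wheelTree]
  · exact vLPPrizeCut_wheel hε1
  · exact vLPPrizeRCut_rootedWheel
  · linarith
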